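/- Let $q>1$, let $\chi$ be a primitive Dirichlet character modulo $q$, let $\overline\chi$ be its complex conjugate, and let $u\in\mathbb R$. Put $\kappa=0$ if $\chi(-1)=1$ and $\kappa=1$ if $\chi(-1)=-1$, and $$g(s,\chi)=\left(\frac q\pi\right)^{\frac{s+\kappa}2}\Gamma\!\left(\frac{s+\kappa}2\right),\qquad \epsilon(\chi)=\frac{1}{i^{\kappa}\sqrt q}\sum_{n=1}^{q}\chi(n)e^{2\pi i n/q},$$ $$L_u(s,\chi)=\prod_{p\le u}\frac1{1-\chi(p)p^{-s}},\qquad \xi_u(s,\chi)=g(s,\chi)L_u(s,\chi).$$ Let $\xi(s,\chi)$ be the completed $L$-function, that is, the entire function that equals $g(s,\chi)L(s,\chi)$ away from the poles of $g$. Let $\xi_u^{pp}(s,\chi)$ be the sum, over all poles $\rho$ of $\xi_u(\cdot,\chi)$, of the principal part of the Laurent expansion at $\rho$, understood as the limit of the sums over $|\rho|<R$ as $R\to\infty$ with $\inf_\rho\bigl|R-|\rho|\bigr|\ge\delta$ (for every $\delta>0$ for which there are arbitrarily large such $R$). Let $\xi_u^{reg}(s,\chi)=\xi_u(s,\chi)-\xi_u^{pp}(s,\chi)$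 with its singularities removed, and put $$\xi_u^{\approx}(s,\chi)=\xi_u^{reg}(s,\chi)+\epsilon(\chi)\,\xi_u^{reg}(1-s,\overline\chi).$$ Let $s_0\in\mathbb C$ and let $\sigma>\max\{1,\ \mathrm{Re}(s_0),\ 1-\mathrm{Re}(s_0)\}$. Then these notions are well defined (such $R$ exist for some $\delta>0$, the limits defining $\xi_u^{pp}(s,\chi)$ and $\xi_u^{pp}(s,\overline\chi)$ exist off the poles, and $\xi_u^{reg}(s,\chi)$ and $\xi_u^{reg}(s,\overline\chi)$ are entire), the integral below converges absolutely, and $$\xi(s_0,\chi)-\xi_u^{\approx}(s_0,\chi)=\frac1{2\pi i}\int_{\mathrm{Re}(s)=\sigma}g(s,\chi)\left(\frac{L(s,\chi)-L_u(s,\chi)}{s-s_0}+\epsilon(\chi)\,\frac{L(s,\overline\chi)-L_u(s,\overline\chi)}{s-(1-s_0)}\right)ds .$$ -/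

import Mathlib

open Complex Filter Topology

noncomputable section

namespace DirichletApprox

/-! ### Principal parts of a meromorphic function on the plane -/

/-- `ρ` is a pole of `f`. -/
def IsPole (f : ℂ → ℂ) (ρ : ℂ) : Prop := meromorphicOrderAt f ρ < 0

/-- The order of the pole of `f` at `ρ` (it is `0` if `ρ` is not a pole). -/
def poleOrder (f : ℂ → ℂ) (ρ : ℂ) : ℕ := (-(meromorphicOrderAt f ρ).untop₀).toNat

/-- The principal part at `ρ` of the Laurent expansion of `f` at `ρ`, as a function of `s`.
If `n` is the order of the pole, then `(z - ρ) ^ n * f z` extends analytically to `ρ`; its Taylor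
coefficients of index `k < n` are the Laurent coefficients of `f` of index `k - n < 0`. -/
def principalPartAt (f : ℂ → ℂ) (ρ s : ℂ) : ℂ :=
  ∑ k ∈ Finset.range (poleOrder f ρ),
    (iteratedDeriv k (toMeromorphicNFAt (fun z => (z - ρ) ^ poleOrder f ρ * f z) ρ) ρ
      / (k.factorial : ℂ)) / (s - ρ) ^ (poleOrder f ρ - k)

/-- The sum of the principal parts of `f` at its poles in the open disc `|ρ| < R`. -/
def partialPrincipalPart (f : ℂ → ℂ) (R : ℝ) (s : ℂ) : ℂ :=
  ∑ᶠ ρ ∈ {ρ : ℂ | IsPole f ρ ∧ ‖ρ‖ < R}, principalPartAt f ρ s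

/-- `R → ∞` while the circle `|z| = R` stays away from the poles of `f`: a statement holds along
this filter iff, for every `δ > 0`, it holds for all large `R` whose distance from the absolute
values of all the poles of `f` is at least `δ`. -/
def admissibleRadii (f : ℂ → ℂ) : Filter ℝ :=
  ⨆ δ : {δ : ℝ // 0 < δ}, atTop ⊓ 𝓟 {R : ℝ | ∀ ρ : ℂ, IsPole f ρ → δ.1 ≤ |R - ‖ρ‖|}

/-- The principal part of `f`: the sum over all poles of `f` of the principal parts, the poles
being exhausted by discs whose boundaries stay away from the poles. -/
def principalPart (f : ℂ → ℂ) (s : ℂ) : ℂ :=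
  limUnder (admissibleRadii f) (fun R => partialPrincipalPart f R s)

/-- The regular part `f - principalPart f`, with its singularities at the poles of `f` removed. -/
def regularPart (f : ℂ → ℂ) (s : ℂ) : ℂ :=
  limUnder (𝓝[≠] s) (fun z => f z - principalPart f z)

/-- The limits that define `principalPart f` and `regularPart f` exist: the sum of principal parts
converges off the poles, and `f - principalPart f` extends to the entire function
`regularPart f`. -/
def HasRegularPart (f : ℂ → ℂ) : Prop :=
  (admissibleRadii f).NeBot ∧
  (∀ s : ℂ, ¬ IsPole f s →
    Tendsto (fun R => partialPrincipalPart f R s) (admissibleRadii f) (𝓝 (principalPart f s))) ∧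
  (∀ s : ℂ, ¬ IsPole f s → regularPart f s = f s - principalPart f s) ∧
  Differentiable ℂ (regularPart f)

/-! ### Dirichlet `L`-functions and their approximations -/

variable {q : ℕ}

open scoped Classical in
/-- `κ(χ)` is `0` for even `χ` and `1` for odd `χ`. -/
def kappa (χ : DirichletCharacter ℂ q) : ℂ := if χ.Even then 0 else 1

/-- The gamma factor `g(s, χ) = (q / π) ^ ((s + κ) / 2) Γ((s + κ) / 2)`. -/
def gFactor (χ : DirichletCharacter ℂ q) (s : ℂ) : ℂ :=
  ((q : ℂ) / (Real.pi : ℂ)) ^ ((s + kappa χ) / 2) * Complex.Gamma ((s + kappa χ) / 2)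

/-- The truncated Euler product `L_u(s, χ)` over the primes `p ≤ u`. -/
def truncL (χ : DirichletCharacter ℂ q) (u : ℝ) (s : ℂ) : ℂ :=
  ∏ p ∈ Nat.primesLE ⌊u⌋₊, 1 / (1 - χ (p : ZMod q) / (p : ℂ) ^ s)

/-- The completed truncated Euler product `ξ_u(s, χ) = g(s, χ) L_u(s, χ)`. -/
def truncXi (χ : DirichletCharacter ℂ q) (u : ℝ) (s : ℂ) : ℂ := gFactor χ s * truncL χ u s

variable [NeZero q]

/-- The completed `L`-function `ξ(s, χ)`, including its values at the poles of `g(s, χ)`;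
see `xi_eq_gFactor_mul_LFunction`. -/
def xi (χ : DirichletCharacter ℂ q) (s : ℂ) : ℂ :=
  (q : ℂ) ^ ((s + kappa χ) / 2) * DirichletCharacter.completedLFunction χ s

/-- `ε(χ) = τ(χ) / (i ^ κ √q)`, where `τ(χ)` is the Gauss sum `∑ χ(n) e ^ (2 π i n / q)`. -/
def eps (χ : DirichletCharacter ℂ q) : ℂ :=
  gaussSum χ ZMod.stdAddChar / (I ^ kappa χ * (Real.sqrt q : ℂ))

/-- `ξ_u^≈(s, χ) = ξ_u^reg(s, χ) + ε(χ) ξ_u^reg(1 - s, χ̄)`; here `χ⁻¹ = χ̄`. -/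
def approxXi (χ : DirichletCharacter ℂ q) (u : ℝ) (s : ℂ) : ℂ :=
  regularPart (truncXi χ u) s + eps χ * regularPart (truncXi χ⁻¹ u) (1 - s)

/-- The integrand
`g(s, χ) ((L(s, χ) - L_u(s, χ)) / (s - s₀) + ε(χ) (L(s, χ̄) - L_u(s, χ̄)) / (s - (1 - s₀)))`. -/
def errorIntegrand (χ : DirichletCharacter ℂ q) (u : ℝ) (s₀ s : ℂ) : ℂ :=
  gFactor χ s *
    ((DirichletCharacter.LFunction χ s - truncL χ u s) / (s - s₀) +
      eps χ * ((DirichletCharacter.LFunction χ⁻¹ s - truncL χ⁻¹ u s) / (s - (1 - s₀))))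

/-- `ξ(s, χ) = g(s, χ) L(s, χ)` away from the poles of `g(s, χ)`. -/
theorem xi_eq_gFactor_mul_LFunction (hq : q ≠ 1) (χ : DirichletCharacter ℂ q) (s : ℂ)
    (hs : ∀ n : ℕ, (s + kappa χ) / 2 ≠ -(n : ℂ)) :
    xi χ s = gFactor χ s * DirichletCharacter.LFunction χ s := by
  have hπ : ((Real.pi : ℝ) : ℂ) ≠ 0 := by exact_mod_cast Real.pi_ne_zero
  have hg : DirichletCharacter.gammaFactor χ s
      = ((Real.pi : ℝ) : ℂ) ^ (-((s + kappa χ) / 2)) * Complex.Gamma ((s + kappa χ) / 2) := by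
    unfold DirichletCharacter.gammaFactor kappa
    split_ifs <;> rw [Complex.Gammaℝ_def, neg_div] <;> simp
  have hne : DirichletCharacter.gammaFactor χ s ≠ 0 := by
    rw [hg]
    refine mul_ne_zero ?_ (Complex.Gamma_ne_zero hs)
    simp [Complex.cpow_eq_zero_iff, hπ]
  have hdiv : ((q : ℂ) / (Real.pi : ℂ)) ^ ((s + kappa χ) / 2)
      = (q : ℂ) ^ ((s + kappa χ) / 2) * (Real.pi : ℂ) ^ (-((s + kappa χ) / 2)) := by
    have h := Complex.mul_cpow_ofReal_nonneg (a := (q : ℝ)) (b := Real.pi⁻¹) (by positivity)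
      (by positivity) ((s + kappa χ) / 2)
    have harg : ((Real.pi : ℝ) : ℂ).arg ≠ Real.pi := by
      rw [Complex.arg_ofReal_of_nonneg Real.pi_pos.le]
      exact Real.pi_ne_zero.symm
    rw [Complex.cpow_neg, ← Complex.inv_cpow _ _ harg, div_eq_mul_inv]
    simpa using h
  rw [DirichletCharacter.LFunction_eq_completed_div_gammaFactor χ s (Or.inr hq), xi, gFactor, hdiv,
    mul_assoc ((q : ℂ) ^ _), ← hg]
  field_simp

/-- `ε(χ)` is the root number of `χ`. -/
theorem eps_eq_rootNumber (χ : DirichletCharacter ℂ q) : eps χ = χ.rootNumber := by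
  have h : ((Real.sqrt q : ℝ) : ℂ) = (q : ℂ) ^ (1 / 2 : ℂ) := by
    rw [Real.sqrt_eq_rpow, Complex.ofReal_cpow (by positivity)]
    simp
  unfold eps DirichletCharacter.rootNumber kappa
  rw [h, ← div_div]
  split_ifs <;> simp

end DirichletApprox

end

/-! Both $\xi(s_0,\chi)$ and $\xi_u^{\approx}(s_0,\chi)$ are sums of two Cauchy integrals over the
same line $\mathrm{Re}\,s=\sigma$, with kernels $1/(s-s_0)$ and $\epsilon(\chi)/(s-(1-s_0))$;
subtracting them under the integral sign gives the formula.

For $\xi$, apply Cauchy's formula on $[1-\sigma,\sigma]\times[-T,T]$. As $\xi$ is bounded in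
vertical strips, the horizontal sides vanish as $T\to\infty$. The functional equation under
$z\mapsto 1-z$ turns the left side into an integral of $\xi(\cdot,\overline\chi)$ over
$\mathrm{Re}\,s=\sigma$ (`xi_eq_lineCauchy`).

For $\xi_u$ there is no functional equation, but there is decay to the left. All its poles lie on
the imaginary axis (Euler factors) or on the nonpositive real axis (gamma factor). The residue
theorem for $\xi_u(z)/(z-s)$ on $[-R,\sigma]\times[-R,R]$ gives $2\pi i$ times $\xi_u(s)$ minus the
principal parts at the poles with $|\rho|<R$. For $R$ away from all $|\rho|$, the super-exponential
decay of $\Gamma$ beats the power of $q/\pi$, and the Euler product stays bounded, so every side but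
the right one contributes $O(1/R)$. Hence the sums of principal parts converge and $\xi_u^{reg}$ is
the Cauchy integral over the right side alone (`HasDecayingReciprocal.regularPart_eq`). That
integral is holomorphic for $\mathrm{Re}\,s<\sigma$, and $\sigma$ is arbitrary, so $\xi_u^{reg}$ is
entire.

The second argument is run for the reciprocal of any entire function satisfying
`HasDecayingReciprocal`; `hasDecayingReciprocal_truncXiInv` verifies this for $1/\xi_u$. Suitable
radii exist because the $|\rho|$ form a finite union of uniformly separated sets. -/

noncomputable section

namespace DirichletApprox

/-! ### Integrals along the boundary of a rectangle -/

/-- The boundary of the rectangle `[a, b] × [c, d]`. -/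
def rectBoundary (a b c d : ℝ) : Set ℂ :=
  {z | z.re ∈ Set.Icc a b ∧ z.im ∈ Set.Icc c d ∧ (z.re = a ∨ z.re = b ∨ z.im = c ∨ z.im = d)}

/-- The integral of `F` along the counterclockwise boundary of the rectangle `[a, b] × [c, d]`. -/
def rectIntegral (F : ℂ → ℂ) (a b c d : ℝ) : ℂ :=
  (∫ x : ℝ in a..b, F (x + c * I)) - (∫ x : ℝ in a..b, F (x + d * I)) +
    I * (∫ y : ℝ in c..d, F (b + y * I)) - I * ∫ y : ℝ in c..d, F (a + y * I)

section rect

variable {F G : ℂ → ℂ} {a b c d : ℝ}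

lemma bottom_mem (hcd : c ≤ d) {x : ℝ} (hx : x ∈ Set.Icc a b) :
    (x + c * I : ℂ) ∈ rectBoundary a b c d := by
  simp_all [rectBoundary]

lemma top_mem (hcd : c ≤ d) {x : ℝ} (hx : x ∈ Set.Icc a b) :
    (x + d * I : ℂ) ∈ rectBoundary a b c d := by
  simp_all [rectBoundary]

lemma right_mem (hab : a ≤ b) {y : ℝ} (hy : y ∈ Set.Icc c d) :
    (b + y * I : ℂ) ∈ rectBoundary a b c d := by
  simp_all [rectBoundary]

lemma left_mem (hab : a ≤ b) {y : ℝ} (hy : y ∈ Set.Icc c d) :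
    (a + y * I : ℂ) ∈ rectBoundary a b c d := by
  simp_all [rectBoundary]

lemma rectIntegral_congr (hab : a ≤ b) (hcd : c ≤ d)
    (h : Set.EqOn F G (rectBoundary a b c d)) :
    rectIntegral F a b c d = rectIntegral G a b c d := by
  unfold rectIntegral
  congr 1
  · congr 1
    · congr 1 <;> refine intervalIntegral.integral_congr fun x hx => h ?_ <;>
        rw [Set.uIcc_of_le hab] at hx
      exacts [bottom_mem hcd hx, top_mem hcd hx]
    · congr 1
      refine intervalIntegral.integral_congr fun x hx => h ?_
      rw [Set.uIcc_of_le hcd] at hx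
      exact right_mem hab hx
  · congr 1
    refine intervalIntegral.integral_congr fun x hx => h ?_
    rw [Set.uIcc_of_le hcd] at hx
    exact left_mem hab hx

lemma intervalIntegrable_sides (hab : a ≤ b) (hcd : c ≤ d)
    (hF : ContinuousOn F (rectBoundary a b c d)) :
    IntervalIntegrable (fun x : ℝ => F (x + c * I)) MeasureTheory.volume a b ∧
    IntervalIntegrable (fun x : ℝ => F (x + d * I)) MeasureTheory.volume a b ∧
    IntervalIntegrable (fun y : ℝ => F (b + y * I)) MeasureTheory.volume c d ∧
    IntervalIntegrable (fun y : ℝ => F (a + y * I)) MeasureTheory.volume c d := by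
  refine ⟨?_, ?_, ?_, ?_⟩ <;> apply ContinuousOn.intervalIntegrable <;>
    first | rw [Set.uIcc_of_le hab] | rw [Set.uIcc_of_le hcd]
  · exact hF.comp (by fun_prop) fun x hx => bottom_mem hcd hx
  · exact hF.comp (by fun_prop) fun x hx => top_mem hcd hx
  · exact hF.comp (by fun_prop) fun x hx => right_mem hab hx
  · exact hF.comp (by fun_prop) fun x hx => left_mem hab hx

lemma rectIntegral_add (hab : a ≤ b) (hcd : c ≤ d)
    (hF : ContinuousOn F (rectBoundary a b c d)) (hG : ContinuousOn G (rectBoundary a b c d)) :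
    rectIntegral (fun z => F z + G z) a b c d =
      rectIntegral F a b c d + rectIntegral G a b c d := by
  obtain ⟨f1, f2, f3, f4⟩ := intervalIntegrable_sides hab hcd hF
  obtain ⟨g1, g2, g3, g4⟩ := intervalIntegrable_sides hab hcd hG
  unfold rectIntegral
  rw [intervalIntegral.integral_add f1 g1, intervalIntegral.integral_add f2 g2,
    intervalIntegral.integral_add f3 g3, intervalIntegral.integral_add f4 g4]
  ring

lemma rectIntegral_const_mul (k : ℂ) :
    rectIntegral (fun z => k * F z) a b c d = k * rectIntegral F a b c d := by
  unfold rectIntegral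
  simp only [intervalIntegral.integral_const_mul]
  ring

lemma rectIntegral_sub (hab : a ≤ b) (hcd : c ≤ d)
    (hF : ContinuousOn F (rectBoundary a b c d)) (hG : ContinuousOn G (rectBoundary a b c d)) :
    rectIntegral (fun z => F z - G z) a b c d =
      rectIntegral F a b c d - rectIntegral G a b c d := by
  have := rectIntegral_add hab hcd hF (hG.const_mul (-1))
  rw [rectIntegral_const_mul] at this
  simpa [sub_eq_add_neg] using this

lemma rectIntegral_sum (hab : a ≤ b) (hcd : c ≤ d) {ι : Type*} (S : Finset ι) (f : ι → ℂ → ℂ)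
    (hf : ∀ i ∈ S, ContinuousOn (f i) (rectBoundary a b c d)) :
    rectIntegral (fun z => ∑ i ∈ S, f i z) a b c d = ∑ i ∈ S, rectIntegral (f i) a b c d := by
  classical
  induction S using Finset.induction_on with
  | empty => simp [rectIntegral]
  | insert i S hi ih =>
    simp only [Finset.sum_insert hi]
    rw [← ih fun j hj => hf j (Finset.mem_insert_of_mem hj)]
    exact rectIntegral_add hab hcd (hf i (Finset.mem_insert_self _ _))
      (continuousOn_finsetSum _ fun j hj => hf j (Finset.mem_insert_of_mem hj))

lemma integral_horizontal {Φ : ℂ → ℂ} (hab : a ≤ b) (h : ℝ)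
    (hd : ∀ x ∈ Set.Icc a b, HasDerivAt Φ (F (x + h * I)) (x + h * I))
    (hF : IntervalIntegrable (fun x : ℝ => F (x + h * I)) MeasureTheory.volume a b) :
    ∫ x : ℝ in a..b, F (x + h * I) = Φ (b + h * I) - Φ (a + h * I) := by
  refine intervalIntegral.integral_eq_sub_of_hasDerivAt (f := fun x : ℝ => Φ (x + h * I))
    (fun x hx => ?_) hF
  rw [Set.uIcc_of_le hab] at hx
  have h1 : HasDerivAt (fun x : ℝ => (x + h * I : ℂ)) 1 x :=
    (Complex.ofRealCLM.hasDerivAt (x := x)).add_const _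
  exact ((hd x hx).comp x h1).congr_deriv (mul_one _)

lemma integral_vertical {Φ : ℂ → ℂ} (hcd : c ≤ d) (h : ℝ)
    (hd : ∀ y ∈ Set.Icc c d, HasDerivAt Φ (F (h + y * I)) (h + y * I))
    (hF : IntervalIntegrable (fun y : ℝ => F (h + y * I)) MeasureTheory.volume c d) :
    I * ∫ y : ℝ in c..d, F (h + y * I) = Φ (h + d * I) - Φ (h + c * I) := by
  rw [← intervalIntegral.integral_const_mul]
  refine intervalIntegral.integral_eq_sub_of_hasDerivAt (f := fun y : ℝ => Φ (h + y * I))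
    (fun y hy => ?_) (hF.const_mul I)
  rw [Set.uIcc_of_le hcd] at hy
  have h1 : HasDerivAt (fun y : ℝ => (h + y * I : ℂ)) I y := by
    simpa using ((Complex.ofRealCLM.hasDerivAt (x := y)).mul_const I).const_add (h : ℂ)
  exact ((hd y hy).comp y h1).congr_deriv (mul_comm _ _)

lemma rectIntegral_eq_zero_of_primitive {Φ : ℂ → ℂ} (hab : a ≤ b) (hcd : c ≤ d)
    (hF : ContinuousOn F (rectBoundary a b c d))
    (hd : ∀ z ∈ rectBoundary a b c d, HasDerivAt Φ (F z) z) :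
    rectIntegral F a b c d = 0 := by
  obtain ⟨f1, f2, f3, f4⟩ := intervalIntegrable_sides hab hcd hF
  unfold rectIntegral
  rw [integral_horizontal hab c (fun x hx => hd _ (bottom_mem hcd hx)) f1,
    integral_horizontal hab d (fun x hx => hd _ (top_mem hcd hx)) f2,
    integral_vertical hcd b (fun x hx => hd _ (right_mem hab hx)) f3,
    integral_vertical hcd a (fun x hx => hd _ (left_mem hab hx)) f4]
  ring

variable {s : ℂ}

/-- `s` lies in the open rectangle `(a, b) × (c, d)`. -/
def InRect (a b c d : ℝ) (s : ℂ) : Prop := a < s.re ∧ s.re < b ∧ c < s.im ∧ s.im < d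

lemma InRect.ne_boundary (hs : InRect a b c d s) {z : ℂ} (hz : z ∈ rectBoundary a b c d) :
    z - s ≠ 0 := by
  obtain ⟨h1, h2, h3, h4⟩ := hs
  intro h
  rw [sub_eq_zero] at h
  subst h
  rcases hz.2.2 with h | h | h | h <;> linarith

lemma InRect.le (hs : InRect a b c d s) : a ≤ b ∧ c ≤ d :=
  ⟨(hs.1.trans hs.2.1).le, (hs.2.2.1.trans hs.2.2.2).le⟩

lemma InRect.continuousOn_inv_pow (hs : InRect a b c d s) (k : ℕ) :
    ContinuousOn (fun z => 1 / (z - s) ^ k) (rectBoundary a b c d) :=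
  continuousOn_const.div (by fun_prop) fun _ hz => pow_ne_zero _ (hs.ne_boundary hz)

lemma InRect.continuousOn_inv (hs : InRect a b c d s) :
    ContinuousOn (fun z => 1 / (z - s)) (rectBoundary a b c d) := by
  simpa only [pow_one] using hs.continuousOn_inv_pow 1

/-- `log (z - s)` is a primitive on the bottom, right and top sides, `log (-(z - s))` on the left
one. The two branches differ at each left corner, and each corner contributes `π * I`. -/
lemma rectIntegral_inv_sub (hs : InRect a b c d s) :
    rectIntegral (fun z => 1 / (z - s)) a b c d = 2 * Real.pi * I := by
  obtain ⟨hab, hcd⟩ := hs.le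
  obtain ⟨f1, f2, f3, f4⟩ := intervalIntegrable_sides hab hcd
    hs.continuousOn_inv
  obtain ⟨h1, h2, h3, h4⟩ := hs
  have hlog : ∀ z, z - s ∈ slitPlane → HasDerivAt (fun z => log (z - s)) (1 / (z - s)) z :=
    fun z hz => ((hasDerivAt_id z).sub_const s).clog hz
  have hlog' : ∀ z, -(z - s) ∈ slitPlane → HasDerivAt (fun z => log (-(z - s))) (1 / (z - s)) z :=
    fun z hz => (((hasDerivAt_id z).sub_const s).fun_neg.clog hz).congr_deriv (neg_div_neg_eq _ _)
  have hpos : ∀ w : ℂ, 0 < w.im → log w - log (-w) = Real.pi * I := by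
    intro w hw
    simp only [log, norm_neg, arg_neg_eq_arg_sub_pi_of_im_pos hw]
    push_cast; ring
  have hneg : ∀ w : ℂ, w.im < 0 → log (-w) - log w = Real.pi * I := by
    intro w hw
    simp only [log, norm_neg, arg_neg_eq_arg_add_pi_of_im_neg hw]
    push_cast; ring
  unfold rectIntegral
  rw [integral_horizontal (F := fun z => 1 / (z - s)) (Φ := fun z => log (z - s)) hab c
      (fun x hx => hlog _ (Or.inr (by simp; linarith))) f1,
    integral_horizontal (F := fun z => 1 / (z - s)) (Φ := fun z => log (z - s)) hab d
      (fun x hx => hlog _ (Or.inr (by simp; linarith))) f2,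
    integral_vertical (F := fun z => 1 / (z - s)) (Φ := fun z => log (z - s)) hcd b
      (fun x hx => hlog _ (Or.inl (by simp; linarith))) f3,
    integral_vertical (F := fun z => 1 / (z - s)) (Φ := fun z => log (-(z - s))) hcd a
      (fun x hx => hlog' _ (Or.inl (by simp; linarith))) f4]
  linear_combination hpos (a + d * I - s) (by simp; linarith) +
    hneg (a + c * I - s) (by simp; linarith)

lemma rectIntegral_inv_sub_pow (hs : InRect a b c d s) (k : ℕ) :
    rectIntegral (fun z => 1 / (z - s) ^ (k + 2)) a b c d = 0 := by
  obtain ⟨hab, hcd⟩ := hs.le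
  refine rectIntegral_eq_zero_of_primitive (Φ := fun z => -1 / (k + 1 : ℂ) * ((z - s) ^ (k + 1))⁻¹)
    hab hcd (hs.continuousOn_inv_pow _) fun z hz => ?_
  have hne := hs.ne_boundary hz
  have hk : (k + 1 : ℂ) ≠ 0 := by exact_mod_cast Nat.succ_ne_zero k
  have := ((((hasDerivAt_id z).sub_const s).pow (k + 1)).inv (pow_ne_zero _ hne)).const_mul
    (-1 / (k + 1 : ℂ))
  refine this.congr_deriv ?_
  simp only [id, Pi.pow_apply, Nat.add_sub_cancel]
  push_cast
  field_simp
  ring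

/-- Partial fractions lower the power of `z - ρ` by one. At a simple pole the residues at `ρ` and
`s` cancel; higher powers of `1 / (z - ρ)` alone integrate to zero. -/
lemma rectIntegral_inv_mul (hs : InRect a b c d s) {ρ : ℂ} (hρ : InRect a b c d ρ) (h : ρ ≠ s)
    (k : ℕ) :
    rectIntegral (fun z => 1 / (z - ρ) ^ (k + 1) * (1 / (z - s))) a b c d = 0 := by
  obtain ⟨hab, hcd⟩ := hs.le
  have hne : ρ - s ≠ 0 := sub_ne_zero.mpr h
  have key : ∀ k : ℕ, rectIntegral (fun z => 1 / (z - ρ) ^ (k + 1) * (1 / (z - s))) a b c d =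
      1 / (ρ - s) * (rectIntegral (fun z => 1 / (z - ρ) ^ (k + 1)) a b c d -
        rectIntegral (fun z => 1 / (z - ρ) ^ k * (1 / (z - s))) a b c d) := by
    intro k
    rw [← rectIntegral_sub hab hcd (hρ.continuousOn_inv_pow _)
      ((hρ.continuousOn_inv_pow _).fun_mul hs.continuousOn_inv),
      ← rectIntegral_const_mul]
    refine rectIntegral_congr hab hcd fun z hz => ?_
    have := hs.ne_boundary hz
    have := hρ.ne_boundary hz
    field_simp
    ring
  induction k with
  | zero => rw [key]; simp [-one_div, rectIntegral_inv_sub hs, rectIntegral_inv_sub hρ]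
  | succ k ih => rw [key, ih, rectIntegral_inv_sub_pow hρ]; simp

/-- Cauchy's integral formula for a rectangle. -/
lemma rectIntegral_cauchy (hs : InRect a b c d s)
    (hF : ∀ z : ℂ, z.re ∈ Set.Icc a b → z.im ∈ Set.Icc c d → DifferentiableAt ℂ F z) :
    rectIntegral (fun z => F z * (1 / (z - s))) a b c d = 2 * Real.pi * I * F s := by
  obtain ⟨hab, hcd⟩ := hs.le
  have hdiffs : DifferentiableAt ℂ F s := hF s ⟨hs.1.le, hs.2.1.le⟩ ⟨hs.2.2.1.le, hs.2.2.2.le⟩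
  -- The divided difference is continuous at `s` and holomorphic elsewhere, so Cauchy's theorem with
  -- a countable exceptional set applies.
  have h0 : rectIntegral (dslope F s) a b c d = 0 := by
    have := integral_boundary_rect_eq_zero_of_differentiable_on_off_countable (dslope F s)
      (a + c * I) (b + d * I) {s} (Set.countable_singleton s) ?_ ?_
    · simpa [rectIntegral] using this
    · intro z hz
      simp only [mem_reProdIm, Set.uIcc_of_le, add_re, ofReal_re, mul_re, I_re, mul_zero, ofReal_im,
        I_im, mul_one, sub_self, add_zero, hab, add_im, mul_im, zero_add, hcd] at hz
      by_cases hzs : z = s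
      · subst hzs
        exact (continuousAt_dslope_same.mpr hdiffs).continuousWithinAt
      · exact ((continuousAt_dslope_of_ne hzs).mpr (hF z hz.1 hz.2).continuousAt).continuousWithinAt
    · rintro z ⟨hz, hzs⟩
      simp only [mem_reProdIm, min_eq_left, max_eq_right, add_re, ofReal_re, mul_re, I_re, mul_zero,
        ofReal_im, I_im, mul_one, sub_self, add_zero, hab, add_im, mul_im, zero_add, hcd] at hz
      exact (differentiableAt_dslope_of_ne hzs).mpr
        (hF z (Set.Ioo_subset_Icc_self hz.1) (Set.Ioo_subset_Icc_self hz.2))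
  have hinv : ContinuousOn (fun z => 1 / (z - s)) (rectBoundary a b c d) :=
    hs.continuousOn_inv
  have hc : ContinuousOn F (rectBoundary a b c d) := fun z hz =>
    (hF z hz.1 hz.2.1).continuousAt.continuousWithinAt
  have h1 : rectIntegral (fun z => F z * (1 / (z - s)) - F s * (1 / (z - s))) a b c d = 0 := by
    rw [← h0]
    refine rectIntegral_congr hab hcd fun z hz => ?_
    have hne := hs.ne_boundary hz
    rw [dslope_of_ne _ (sub_ne_zero.mp hne), slope_def_field]
    field_simp
  rw [rectIntegral_sub hab hcd (hc.fun_mul hinv) (continuousOn_const.fun_mul hinv), rectIntegral_const_mul,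
    rectIntegral_inv_sub hs] at h1
  linear_combination h1

end rect

/-! ### Principal parts -/

section principalParts

variable {f : ℂ → ℂ} {ρ : ℂ}

/-- Taylor's formula with the iterated divided difference as remainder: a purely algebraic identity,
with no regularity of `F` needed. For analytic `F` the remainder is again analytic at `ρ`. -/
lemma eq_sum_add_pow_mul_iterate_dslope (F : ℂ → ℂ) (ρ z : ℂ) (n : ℕ) :
    F z = ∑ k ∈ Finset.range n, ((Function.swap dslope ρ)^[k] F ρ) * (z - ρ) ^ k +
      (z - ρ) ^ n * (Function.swap dslope ρ)^[n] F z := by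
  induction n with
  | zero => simp
  | succ n ih =>
    have h := sub_smul_dslope ((Function.swap dslope ρ)^[n] F) ρ z
    rw [smul_eq_mul] at h
    rw [Finset.sum_range_succ, Function.iterate_succ_apply']
    simp only [Function.swap] at h ih ⊢
    rw [ih]
    linear_combination -(z - ρ) ^ n * h

lemma iterate_dslope_eq_iteratedDeriv {F : ℂ → ℂ} (hF : AnalyticAt ℂ F ρ) (k : ℕ) :
    (Function.swap dslope ρ)^[k] F ρ = iteratedDeriv k F ρ / (k.factorial : ℂ) := by
  have hp := hF.hasFPowerSeriesAt
  rw [← (hp.has_fpower_series_iterate_dslope_fslope k).coeff_zero 1,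
    ← FormalMultilinearSeries.coeff, FormalMultilinearSeries.coeff_iterate_fslope]
  simp

lemma meromorphicOrderAt_pow_poleOrder_mul (hf : MeromorphicAt f ρ) :
    0 ≤ meromorphicOrderAt (fun z => (z - ρ) ^ poleOrder f ρ * f z) ρ := by
  rw [fun_meromorphicOrderAt_mul (by fun_prop) hf, fun_meromorphicOrderAt_pow_id_sub_const]
  rcases h : meromorphicOrderAt f ρ with _ | n
  · exact le_top
  · have h1 : (0 : ℤ) ≤ ((-n).toNat : ℤ) + n := by omega
    have h2 : poleOrder f ρ = (-n).toNat := by rw [poleOrder, h]; rfl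
    rw [h2]
    exact WithTop.coe_le_coe.mpr h1

/-- Subtracting the principal part at `ρ` leaves a function with a removable singularity. -/
lemma exists_analyticAt_eq_add_principalPartAt (hf : MeromorphicAt f ρ) :
    ∃ H : ℂ → ℂ, AnalyticAt ℂ H ρ ∧ ∀ z ≠ ρ, f z = principalPartAt f ρ z + H z := by
  set n := poleOrder f ρ with hn
  set F := toMeromorphicNFAt (fun z => (z - ρ) ^ n * f z) ρ with hFdef
  have hmer : MeromorphicAt (fun z => (z - ρ) ^ n * f z) ρ := by fun_prop
  have hF : AnalyticAt ℂ F ρ :=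
    hmer.meromorphicOrderAt_nonneg_iff_analyticAt_toMeromorphicNFAt.mp
      (meromorphicOrderAt_pow_poleOrder_mul hf)
  refine ⟨(Function.swap dslope ρ)^[n] F,
    (hF.hasFPowerSeriesAt.has_fpower_series_iterate_dslope_fslope n).analyticAt, fun z hz => ?_⟩
  have hzρ : z - ρ ≠ 0 := sub_ne_zero.mpr hz
  have h1 : (z - ρ) ^ n * f z = F z := hmer.eqOn_compl_singleton_toMeromorphicNFAt hz
  rw [eq_sum_add_pow_mul_iterate_dslope F ρ z n] at h1
  simp only [iterate_dslope_eq_iteratedDeriv hF] at h1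
  have hpp : principalPartAt f ρ z * (z - ρ) ^ n =
      ∑ k ∈ Finset.range n, iteratedDeriv k F ρ / (k.factorial : ℂ) * (z - ρ) ^ k := by
    rw [principalPartAt, Finset.sum_mul]
    refine Finset.sum_congr rfl fun k hk => ?_
    have : (z - ρ) ^ n = (z - ρ) ^ (n - k) * (z - ρ) ^ k := by
      rw [← pow_add, Nat.sub_add_cancel (Finset.mem_range.mp hk).le]
    rw [← hn, this]
    field_simp
    rfl
  refine mul_left_cancel₀ (pow_ne_zero n hzρ) ?_
  rw [h1, ← hpp]
  ring

lemma analyticAt_principalPartAt {z : ℂ} (hz : z ≠ ρ) : AnalyticAt ℂ (principalPartAt f ρ) z := by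
  unfold principalPartAt
  refine Finset.analyticAt_fun_sum _ fun k _ => ?_
  exact analyticAt_const.div (by fun_prop) (pow_ne_zero _ (sub_ne_zero.mpr hz))

/-- Replacing the values of `g` by its limits removes a removable singularity. -/
lemma limUnder_nhdsNE_eventuallyEq {g H : ℂ → ℂ} {z : ℂ} (hH : AnalyticAt ℂ H z)
    (h : g =ᶠ[𝓝[≠] z] H) : (fun w => limUnder (𝓝[≠] w) g) =ᶠ[𝓝 z] H := by
  filter_upwards [(eventually_nhdsWithin_iff.mp h).eventually_nhds, hH.eventually_analyticAt]
    with w hw hHw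
  refine Tendsto.limUnder_eq ((hHw.continuousAt.mono_left nhdsWithin_le_nhds).congr' ?_)
  by_cases hwz : w = z
  · subst hwz
    exact (eventually_nhdsWithin_iff.mpr hw).mono fun _ => Eq.symm
  · filter_upwards [nhdsWithin_le_nhds hw, nhdsWithin_le_nhds (isOpen_ne.mem_nhds hwz)]
      with v hv hvz using (hv hvz).symm

variable {a b c d : ℝ} {s : ℂ}

lemma rectIntegral_principalPartAt (hs : InRect a b c d s) (hρ : InRect a b c d ρ) (h : ρ ≠ s) :
    rectIntegral (fun z => principalPartAt f ρ z * (1 / (z - s))) a b c d = 0 := by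
  obtain ⟨hab, hcd⟩ := hs.le
  simp only [principalPartAt, Finset.sum_mul]
  rw [rectIntegral_sum hab hcd]
  · refine Finset.sum_eq_zero fun k hk => ?_
    obtain ⟨m, hm⟩ := Nat.exists_eq_succ_of_ne_zero
      (Nat.sub_ne_zero_of_lt (Finset.mem_range.mp hk))
    simp only [hm, div_eq_mul_one_div (_ / _), mul_assoc (_ / _)]
    rw [rectIntegral_const_mul, Nat.succ_eq_add_one, rectIntegral_inv_mul hs hρ h, mul_zero]
  · intro k _
    simp only [div_eq_mul_one_div (_ / _)]
    exact (continuousOn_const.fun_mul (hρ.continuousOn_inv_pow _)).fun_mul hs.continuousOn_inv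

/-- The residue theorem for `f z / (z - s)`. -/
lemma rectIntegral_meromorphic (hs : InRect a b c d s) (S : Finset ℂ)
    (hS : ∀ ρ ∈ S, InRect a b c d ρ ∧ MeromorphicAt f ρ) (hsS : s ∉ S)
    (hf : ∀ z : ℂ, z.re ∈ Set.Icc a b → z.im ∈ Set.Icc c d → z ∉ S → AnalyticAt ℂ f z) :
    rectIntegral (fun z => f z * (1 / (z - s))) a b c d =
      2 * Real.pi * I * (f s - ∑ ρ ∈ S, principalPartAt f ρ s) := by
  obtain ⟨hab, hcd⟩ := hs.le
  set P : ℂ → ℂ := fun z => ∑ ρ ∈ S, principalPartAt f ρ z with hP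
  have hPan : ∀ z ∉ S, AnalyticAt ℂ P z := fun z hz =>
    Finset.analyticAt_fun_sum _ fun ρ hρ => analyticAt_principalPartAt fun h => hz (h ▸ hρ)
  have hext : ∀ z : ℂ, z.re ∈ Set.Icc a b → z.im ∈ Set.Icc c d →
      ∃ H, AnalyticAt ℂ H z ∧ (fun w => f w - P w) =ᶠ[𝓝[≠] z] H := by
    intro z hz1 hz2
    by_cases hz : z ∈ S
    · classical
      obtain ⟨H, hH, hfH⟩ := exists_analyticAt_eq_add_principalPartAt (hS z hz).2
      refine ⟨fun w => H w - ∑ ρ ∈ S.erase z, principalPartAt f ρ w, hH.fun_sub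
        (Finset.analyticAt_fun_sum _ fun ρ hρ => analyticAt_principalPartAt
          (Finset.ne_of_mem_erase hρ).symm), ?_⟩
      filter_upwards [self_mem_nhdsWithin] with w hw
      simp only [hP]
      rw [← Finset.add_sum_erase S _ hz, hfH w hw]
      ring
    · exact ⟨_, (hf z hz1 hz2 hz).fun_sub (hPan z hz), EventuallyEq.rfl⟩
  -- With its removable singularities filled, `f - P` is holomorphic on the closed rectangle, so
  -- Cauchy's formula applies; `P` itself contributes nothing to the integral.
  set h : ℂ → ℂ := fun z => limUnder (𝓝[≠] z) (fun w => f w - P w) with hh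
  have hdiff : ∀ z : ℂ, z.re ∈ Set.Icc a b → z.im ∈ Set.Icc c d → DifferentiableAt ℂ h z := by
    intro z hz1 hz2
    obtain ⟨H, hH, heq⟩ := hext z hz1 hz2
    exact (hH.congr (limUnder_nhdsNE_eventuallyEq hH heq).symm).differentiableAt
  have hself : ∀ z : ℂ, z.re ∈ Set.Icc a b → z.im ∈ Set.Icc c d → z ∉ S → h z = f z - P z :=
    fun z hz1 hz2 hz => (limUnder_nhdsNE_eventuallyEq
      ((hf z hz1 hz2 hz).fun_sub (hPan z hz)) EventuallyEq.rfl).self_of_nhds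
  have hbd : ∀ z ∈ rectBoundary a b c d, z ∉ S := fun z hz hzS =>
    (hS z hzS).1.ne_boundary hz (sub_self z)
  have hPc : ContinuousOn P (rectBoundary a b c d) := fun z hz =>
    (hPan z (hbd z hz)).continuousAt.continuousWithinAt
  have hfc : ContinuousOn f (rectBoundary a b c d) := fun z hz =>
    (hf z hz.1 hz.2.1 (hbd z hz)).continuousAt.continuousWithinAt
  have hPint : rectIntegral (fun z => P z * (1 / (z - s))) a b c d = 0 := by
    simp only [hP, Finset.sum_mul]
    rw [rectIntegral_sum hab hcd]
    · exact Finset.sum_eq_zero fun ρ hρ =>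
        rectIntegral_principalPartAt hs (hS ρ hρ).1 fun h => hsS (h ▸ hρ)
    · exact fun ρ hρ => ContinuousOn.fun_mul (fun z hz => (analyticAt_principalPartAt
        (ne_of_mem_of_not_mem hρ (hbd z hz)).symm).continuousAt.continuousWithinAt) hs.continuousOn_inv
  have hmain := rectIntegral_cauchy hs hdiff
  rw [hself s ⟨hs.1.le, hs.2.1.le⟩ ⟨hs.2.2.1.le, hs.2.2.2.le⟩ hsS] at hmain
  rw [← hmain, ← sub_zero (rectIntegral _ a b c d), ← hPint,
    ← rectIntegral_sub hab hcd (hfc.fun_mul hs.continuousOn_inv) (hPc.fun_mul hs.continuousOn_inv)]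
  refine rectIntegral_congr hab hcd fun z hz => ?_
  simp only [hself z hz.1 hz.2.1 (hbd z hz)]
  ring

end principalParts

/-! ### Cauchy integrals along vertical lines -/

section line

open MeasureTheory

/-- The Cauchy integral of `φ`, a function on the line `Re z = σ` parametrised by `Im z`. -/
def lineCauchy (φ : ℝ → ℂ) (σ : ℝ) (s : ℂ) : ℂ :=
  1 / (2 * (Real.pi : ℂ) * I) * ∫ t : ℝ, φ t * (1 / (σ + t * I - s)) * I

variable {σ C : ℝ} {φ : ℝ → ℂ}

lemma line_norm_pos (hσ : 0 < σ) (t : ℝ) : 0 < ‖(σ + t * I : ℂ)‖ :=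
  hσ.trans_le (by simpa using re_le_norm (σ + t * I : ℂ))

lemma integrable_inv_line_sq (hσ : 0 < σ) :
    Integrable (fun t : ℝ => 1 / ‖(σ + t * I : ℂ)‖ ^ 2) := by
  have h1 : Integrable (fun t : ℝ => (1 / min 1 (σ ^ 2)) * (1 + t ^ 2)⁻¹) :=
    integrable_inv_one_add_sq.const_mul _
  have hm : 0 < min 1 (σ ^ 2) := lt_min one_pos (by positivity)
  refine h1.mono' ?_ (Eventually.of_forall fun t => ?_)
  · refine Continuous.aestronglyMeasurable (Continuous.div (by fun_prop) (by fun_prop) fun t => ?_)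
    exact pow_ne_zero _ (line_norm_pos hσ t).ne'
  · rw [Real.norm_of_nonneg (by positivity), Complex.sq_norm, normSq_add_mul_I, ← one_div,
      one_div_mul_one_div]
    refine one_div_le_one_div_of_le (by positivity) ?_
    have := min_le_left 1 (σ ^ 2)
    have := min_le_right 1 (σ ^ 2)
    nlinarith [sq_nonneg t]

/-- The bound depends on `s` only through `r` and `M`, hence can dominate the integrand on a whole
disc when differentiating under the integral sign. -/
lemma norm_inv_line_sub_le (hσ : 0 < σ) {s : ℂ} {r M : ℝ} (hr : 0 < r) (hs : s.re + r ≤ σ)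
    (hM : ‖s‖ ≤ M) (t : ℝ) :
    r ≤ ‖(σ + t * I - s : ℂ)‖ ∧ ‖1 / (σ + t * I - s : ℂ)‖ ≤ (1 + M / r) / ‖(σ + t * I : ℂ)‖ := by
  have hle : r ≤ ‖(σ + t * I - s : ℂ)‖ := by
    refine le_trans ?_ (re_le_norm _)
    simp; linarith
  refine ⟨hle, ?_⟩
  have hpos := line_norm_pos hσ t
  have hw : 0 < ‖(σ + t * I - s : ℂ)‖ := hr.trans_le hle
  rw [norm_div, norm_one, div_le_div_iff₀ hw hpos, one_mul, add_mul, one_mul]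
  have h1 : ‖(σ + t * I : ℂ)‖ ≤ ‖(σ + t * I - s : ℂ)‖ + ‖s‖ := by
    simpa using norm_add_le (σ + t * I - s : ℂ) s
  have h2 : M ≤ M / r * ‖(σ + t * I - s : ℂ)‖ := by
    rw [div_mul_eq_mul_div, le_div_iff₀ hr]
    exact mul_le_mul_of_nonneg_left hle ((norm_nonneg s).trans hM)
  linarith

lemma line_sub_ne_zero {s : ℂ} (hs : s.re < σ) (t : ℝ) : (σ + t * I - s : ℂ) ≠ 0 := by
  intro h
  have := congrArg re h
  simp at this
  linarith

lemma integrable_lineCauchy (hσ : 0 < σ) (hφ : Continuous φ)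
    (hb : ∀ t, ‖φ t‖ ≤ C / ‖(σ + t * I : ℂ)‖) {s : ℂ} (hs : s.re < σ) :
    Integrable (fun t : ℝ => φ t * (1 / (σ + t * I - s))) := by
  have hr : 0 < σ - s.re := sub_pos.mpr hs
  refine ((integrable_inv_line_sq hσ).const_mul (C * (1 + ‖s‖ / (σ - s.re)))).mono'
    (Continuous.aestronglyMeasurable ?_) (Eventually.of_forall fun t => ?_)
  · exact hφ.mul (continuous_const.div (by fun_prop) (line_sub_ne_zero hs))
  · have h1 := (norm_inv_line_sub_le hσ hr (by linarith) le_rfl t).2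
    rw [norm_mul]
    refine (mul_le_mul (hb t) h1 (norm_nonneg _) ((norm_nonneg _).trans (hb t))).trans_eq ?_
    ring

lemma differentiableAt_lineCauchy (hσ : 0 < σ) (hφ : Continuous φ)
    (hb : ∀ t, ‖φ t‖ ≤ C / ‖(σ + t * I : ℂ)‖) {s : ℂ} (hs : s.re < σ) :
    DifferentiableAt ℂ (lineCauchy φ σ) s := by
  set r : ℝ := (σ - s.re) / 2 with hr
  have hr0 : 0 < r := by simp only [hr]; linarith
  have hball : ∀ w ∈ Metric.ball s r, w.re + r ≤ σ ∧ ‖w‖ ≤ ‖s‖ + r := by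
    intro w hw
    rw [Metric.mem_ball, dist_eq] at hw
    constructor
    · have := (re_le_norm (w - s)).trans hw.le
      simp at this
      linarith
    · have := norm_add_le (w - s) s
      simp at this
      linarith
  have hcont : ∀ w ∈ Metric.ball s r, Continuous fun t : ℝ => φ t * (1 / (σ + t * I - w)) * I :=
    fun w hw => (hφ.mul (continuous_const.div (by fun_prop)
      (line_sub_ne_zero (by linarith [(hball w hw).1])))).mul continuous_const
  have := hasDerivAt_integral_of_dominated_loc_of_deriv_le (𝕜 := ℂ) (μ := (volume : Measure ℝ))
    (F := fun w (t : ℝ) => φ t * (1 / (σ + t * I - w)) * I)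
    (F' := fun w (t : ℝ) => φ t * (1 / (σ + t * I - w) ^ 2) * I)
    (bound := fun t => C * ((1 + (‖s‖ + r) / r) / r) * (1 / ‖(σ + t * I : ℂ)‖ ^ 2))
    (Metric.ball_mem_nhds s hr0)
    (eventually_of_mem (Metric.ball_mem_nhds s hr0)
      fun w hw => (hcont w hw).aestronglyMeasurable)
    ((integrable_lineCauchy hσ hφ hb hs).mul_const I)
    (Continuous.aestronglyMeasurable ((hφ.mul (continuous_const.div (by fun_prop)
      fun t => pow_ne_zero 2 (line_sub_ne_zero hs t))).mul continuous_const))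
    (Eventually.of_forall fun t w hw => ?_)
    ((integrable_inv_line_sq hσ).const_mul _)
    (Eventually.of_forall fun t w hw => ?_)
  · exact (this.2.differentiableAt).const_mul _
  · obtain ⟨h1, h2⟩ := norm_inv_line_sub_le hσ hr0 (hball w hw).1 (hball w hw).2 t
    have h3 : ‖1 / (σ + t * I - w : ℂ) ^ 2‖ ≤ (1 + (‖s‖ + r) / r) / ‖(σ + t * I : ℂ)‖ * (1 / r) := by
      rw [sq, ← one_div_mul_one_div, norm_mul]
      refine mul_le_mul h2 ?_ (norm_nonneg _) ((norm_nonneg _).trans h2)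
      rw [norm_div, norm_one]
      exact one_div_le_one_div_of_le hr0 h1
    rw [norm_mul, norm_I, mul_one, norm_mul]
    refine (mul_le_mul (hb t) h3 (norm_nonneg _) ((norm_nonneg _).trans (hb t))).trans_eq ?_
    ring
  · have hne := line_sub_ne_zero (σ := σ) (s := w) (by linarith [(hball w hw).1]) t
    have h1 : HasDerivAt (fun w : ℂ => (σ + t * I - w : ℂ)) (-1) w := by
      simpa using (hasDerivAt_id w).const_sub (σ + t * I : ℂ)
    have h2 := ((h1.inv hne).const_mul (φ t)).mul_const I
    simpa [one_div] using h2

end line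

/-! ### The regular part of the reciprocal of an entire function -/

section regular

/-- `E` is an entire function with zeros on `Re z = 0` and `(-∞, 0]`, whose reciprocal decays fast
enough to the left, and along vertical lines, for the sum of its principal parts to be given by a
Cauchy integral. -/
structure HasDecayingReciprocal (E : ℂ → ℂ) : Prop where
  differentiable : Differentiable ℂ E
  ne_zero : ∃ z, E z ≠ 0
  zeros : ∀ ρ, E ρ = 0 → ρ.re ≤ 0 ∧ (ρ.re = 0 ∨ ρ.im = 0)
  radii : ∃ δ : ℝ, 0 < δ ∧ ∃ᶠ R : ℝ in atTop, ∀ ρ, E ρ = 0 → δ ≤ |R - ‖ρ‖|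
  bound : ∀ δ : ℝ, 0 < δ → ∀ c : ℝ, 0 < c → ∃ C : ℝ, ∀ᶠ R : ℝ in atTop, (∀ ρ, E ρ = 0 → δ ≤ |R - ‖ρ‖|) →
    ∀ z : ℂ, z.re ≤ c → (z.re = -R ∨ |z.im| = R) → ‖(E z)⁻¹‖ ≤ C * Real.exp z.re
  vertical : ∀ c : ℝ, 0 < c → ∃ C : ℝ, ∀ t : ℝ, ‖(E (c + t * I))⁻¹‖ ≤ C / ‖(c + t * I : ℂ)‖

namespace HasDecayingReciprocal

variable {E : ℂ → ℂ}

lemma analyticAt (hE : HasDecayingReciprocal E) (z : ℂ) : AnalyticAt ℂ E z :=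
  hE.differentiable.analyticAt z

lemma meromorphicAt_inv (hE : HasDecayingReciprocal E) (z : ℂ) :
    MeromorphicAt (fun z => (E z)⁻¹) z :=
  (hE.analyticAt z).meromorphicAt.fun_inv

lemma eventually_ne_zero (hE : HasDecayingReciprocal E) (z : ℂ) : ∀ᶠ w in 𝓝[≠] z, E w ≠ 0 := by
  by_contra h
  obtain ⟨w, hw⟩ := hE.ne_zero
  have h1 : ∃ᶠ w in 𝓝[≠] z, E w = 0 := h
  exact hw (AnalyticOnNhd.eqOn_zero_of_preconnected_of_frequently_eq_zero
    (U := Set.univ) (fun x _ => hE.analyticAt x) isPreconnected_univ (Set.mem_univ z) h1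
    (Set.mem_univ w))

lemma isPole_iff (hE : HasDecayingReciprocal E) (ρ : ℂ) :
    IsPole (fun z => (E z)⁻¹) ρ ↔ E ρ = 0 := by
  have hm := (hE.analyticAt ρ).meromorphicAt
  unfold IsPole
  constructor
  · intro h
    by_contra h0
    exact h.not_ge ((hE.analyticAt ρ).fun_inv h0).meromorphicOrderAt_nonneg
  · intro h0
    have hpos : 0 < meromorphicOrderAt E ρ := by
      rw [← tendsto_zero_iff_meromorphicOrderAt_pos hm, ← h0]
      exact (hE.analyticAt ρ).continuousAt.tendsto.mono_left nhdsWithin_le_nhds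
    have hne : meromorphicOrderAt E ρ ≠ ⊤ :=
      (meromorphicOrderAt_ne_top_iff_eventually_ne_zero hm).mpr (hE.eventually_ne_zero ρ)
    rw [fun_meromorphicOrderAt_inv]
    lift meromorphicOrderAt E ρ to ℤ using hne with n hn
    have : -n < 0 := by simpa using hpos
    exact WithTop.coe_lt_coe.mpr this

lemma finite_zeros (hE : HasDecayingReciprocal E) (R : ℝ) :
    {ρ : ℂ | E ρ = 0 ∧ ‖ρ‖ < R}.Finite := by
  by_contra h
  obtain ⟨z, -, hz⟩ := Set.Infinite.exists_accPt_of_subset_isCompact h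
    (isCompact_closedBall (0 : ℂ) R) fun ρ hρ => by simpa using hρ.2.le
  have h1 := accPt_iff_frequently_nhdsNE.mp hz
  exact h1 ((hE.eventually_ne_zero z).mono fun w hw hw' => hw hw'.1)

lemma partialPrincipalPart_eq (hE : HasDecayingReciprocal E) (R : ℝ) (s : ℂ) :
    partialPrincipalPart (fun z => (E z)⁻¹) R s =
      ∑ ρ ∈ (hE.finite_zeros R).toFinset, principalPartAt (fun z => (E z)⁻¹) ρ s := by
  unfold partialPrincipalPart
  simp only [hE.isPole_iff]
  exact finsum_mem_eq_finite_toFinset_sum _ _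

/-- The set of radii at distance at least `δ` from the absolute values of the zeros. -/
def goodRadii (E : ℂ → ℂ) (δ : ℝ) : Set ℝ := {R | ∀ ρ, E ρ = 0 → δ ≤ |R - ‖ρ‖|}

/-- Since the zeros of `E` lie on the axes, those in the rectangle are exactly those in the disc
`‖z‖ < R`; a good radius excludes `‖ρ‖ = R`, so none is on the boundary. -/
lemma rectIntegral_eq (hE : HasDecayingReciprocal E) {δ R σ : ℝ} {s : ℂ} (hδ : 0 < δ) (hσ : 0 < σ)
    (hR : R ∈ goodRadii E δ) (hs : E s ≠ 0) (hsσ : s.re < σ) (hsR : ‖s‖ < R) :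
    rectIntegral (fun z => (E z)⁻¹ * (1 / (z - s))) (-R) σ (-R) R =
      2 * Real.pi * I * ((E s)⁻¹ - partialPrincipalPart (fun z => (E z)⁻¹) R s) := by
  have hre : ∀ z : ℂ, ‖z‖ < R → -R < z.re ∧ -R < z.im ∧ z.im < R := by
    intro z hz
    have h1 := abs_lt.mp ((abs_re_le_norm z).trans_lt hz)
    have h2 := abs_lt.mp ((abs_im_le_norm z).trans_lt hz)
    exact ⟨h1.1, h2.1, h2.2⟩
  rw [hE.partialPrincipalPart_eq]
  refine rectIntegral_meromorphic ⟨(hre s hsR).1, hsσ, (hre s hsR).2⟩ _ ?_ (by simp [hs]) ?_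
  · intro ρ hρ
    simp only [Set.Finite.mem_toFinset, Set.mem_ofPred_eq] at hρ
    exact ⟨⟨(hre ρ hρ.2).1, (hE.zeros ρ hρ.1).1.trans_lt hσ, (hre ρ hρ.2).2⟩,
      hE.meromorphicAt_inv ρ⟩
  · intro z hz1 hz2 hzS
    refine (hE.analyticAt z).fun_inv fun h0 => hzS ?_
    simp only [Set.Finite.mem_toFinset, Set.mem_ofPred_eq]
    refine ⟨h0, lt_of_le_of_ne ?_ fun h => ?_⟩
    · obtain ⟨h1, h2⟩ := hE.zeros z h0
      rcases h2 with h2 | h2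
      · rw [← abs_im_eq_norm.mpr h2]
        exact abs_le.mpr hz2
      · rw [← abs_re_eq_norm.mpr h2, abs_of_nonpos h1]
        linarith [hz1.1]
    · have := hR z h0
      simp [h] at this
      linarith

/-- The kernel is at most `2 / R` on the three sides. On the horizontal ones `exp (re z)` has
integral at most `exp σ`, whatever their length; on the left one `exp (-R) ≤ 1 / R` offsets the
length `2 * R`. -/
lemma norm_rectIntegral_sub_le {F : ℂ → ℂ} {C R σ : ℝ} {s : ℂ} (hσ : 0 < σ) (hR : 0 < R)
    (hsR : 2 * ‖s‖ ≤ R)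
    (hF : ∀ z : ℂ, z.re ≤ σ → (z.re = -R ∨ |z.im| = R) → ‖F z‖ ≤ C * Real.exp z.re) :
    ‖rectIntegral (fun z => F z * (1 / (z - s))) (-R) σ (-R) R -
      I * ∫ t : ℝ in -R..R, F (σ + t * I) * (1 / (σ + t * I - s))‖ ≤
      (4 * C * Real.exp σ + 4 * C) / R := by
  have hC : 0 ≤ C := by
    have h := (norm_nonneg _).trans (hF (-R : ℝ) (by simp; linarith) (by simp))
    exact nonneg_of_mul_nonneg_left h (Real.exp_pos _)
  have hker : ∀ z : ℂ, R ≤ ‖z‖ → ‖1 / (z - s)‖ ≤ 2 / R := by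
    intro z hz
    have h1 : R / 2 ≤ ‖z - s‖ := by
      have := norm_sub_norm_le z s
      linarith
    rw [norm_div, norm_one]
    exact (one_div_le_one_div_of_le (by positivity) h1).trans_eq (by field_simp)
  have hint : ∀ z : ℂ, z.re ≤ σ → (z.re = -R ∨ |z.im| = R) →
      ‖F z * (1 / (z - s))‖ ≤ 2 * C / R * Real.exp z.re := by
    intro z h1 h2
    have h3 : R ≤ ‖z‖ := by
      rcases h2 with h2 | h2
      · have := abs_re_le_norm z
        rwa [h2, abs_neg, abs_of_pos hR] at this
      · rw [← h2]
        exact abs_im_le_norm z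
    rw [norm_mul]
    refine (mul_le_mul (hF z h1 h2) (hker z h3) (norm_nonneg _) (by positivity)).trans_eq ?_
    ring
  have hhor : ∀ h : ℝ, |h| = R →
      ‖∫ x : ℝ in (-R)..σ, F (x + h * I) * (1 / (x + h * I - s))‖ ≤ 2 * C / R * Real.exp σ := by
    intro h hh
    have h1 : ‖∫ x : ℝ in (-R)..σ, F (x + h * I) * (1 / (x + h * I - s))‖ ≤
        ∫ x : ℝ in (-R)..σ, 2 * C / R * Real.exp x := by
      refine intervalIntegral.norm_integral_le_of_norm_le (by linarith)
        (Eventually.of_forall fun x hx => ?_) (Continuous.intervalIntegrable (by fun_prop) _ _)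
      simpa using hint (x + h * I) (by simpa using hx.2) (Or.inr (by simpa using hh))
    refine h1.trans ?_
    rw [intervalIntegral.integral_const_mul, integral_exp]
    have := Real.exp_pos (-R)
    exact mul_le_mul_of_nonneg_left (by linarith) (by positivity)
  have hleft : ‖∫ y : ℝ in (-R)..R, F ((-R : ℝ) + y * I) * (1 / ((-R : ℝ) + y * I - s))‖ ≤
      4 * C / R := by
    have h1 := intervalIntegral.norm_integral_le_of_norm_le_const (a := -R) (b := R)
      (C := 2 * C / R * Real.exp (-R))
      (f := fun y : ℝ => F ((-R : ℝ) + y * I) * (1 / ((-R : ℝ) + y * I - s))) fun y hy => by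
        simpa using hint ((-R : ℝ) + y * I) (by simp; linarith) (Or.inl (by simp))
    refine h1.trans ?_
    have h2 : Real.exp (-R) ≤ 1 / R := by
      rw [Real.exp_neg, ← one_div]
      exact one_div_le_one_div_of_le hR (by linarith [Real.add_one_le_exp R])
    rw [sub_neg_eq_add, abs_of_pos (by positivity)]
    calc 2 * C / R * Real.exp (-R) * (R + R) ≤ 2 * C / R * (1 / R) * (R + R) := by gcongr
      _ = 4 * C / R := by field_simp; ring
  have hb := hhor (-R) (by rw [abs_neg, abs_of_pos hR])
  have ht := hhor R (abs_of_pos hR)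
  set X := ∫ x : ℝ in (-R)..σ, F (x + (-R : ℝ) * I) * (1 / (x + (-R : ℝ) * I - s)) with hX
  set Y := ∫ x : ℝ in (-R)..σ, F (x + (R : ℝ) * I) * (1 / (x + (R : ℝ) * I - s)) with hY
  set Z := ∫ y : ℝ in (-R)..R, F ((-R : ℝ) + y * I) * (1 / ((-R : ℝ) + y * I - s)) with hZ
  have hsplit : rectIntegral (fun z => F z * (1 / (z - s))) (-R) σ (-R) R -
      I * ∫ t : ℝ in -R..R, F (σ + t * I) * (1 / (σ + t * I - s)) = X - Y - I * Z := by
    unfold rectIntegral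
    ring
  rw [hsplit]
  have h1 := norm_sub_le (X - Y) (I * Z)
  have h2 := norm_sub_le X Y
  rw [norm_mul, norm_I, one_mul] at h1
  have h3 : (4 * C * Real.exp σ + 4 * C) / R =
      2 * C / R * Real.exp σ + 2 * C / R * Real.exp σ + 4 * C / R := by ring
  linarith

lemma continuous_line (hE : HasDecayingReciprocal E) {σ : ℝ} (hσ : 0 < σ) :
    Continuous fun t : ℝ => (E (σ + t * I))⁻¹ := by
  refine Continuous.inv₀ (hE.differentiable.continuous.comp (by fun_prop)) fun t h => ?_
  have := (hE.zeros _ h).1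
  simp at this
  linarith

lemma integrable_line (hE : HasDecayingReciprocal E) {σ : ℝ} {s : ℂ} (hσ : 0 < σ)
    (hs : s.re < σ) :
    MeasureTheory.Integrable fun t : ℝ => (E (σ + t * I))⁻¹ * (1 / (σ + t * I - s)) :=
  have ⟨_, hC⟩ := hE.vertical σ hσ
  integrable_lineCauchy hσ (hE.continuous_line hσ) hC hs

lemma tendsto_partialPrincipalPart (hE : HasDecayingReciprocal E) {σ : ℝ} {s : ℂ} (hσ : 0 < σ)
    (hs : s.re < σ) (hs0 : E s ≠ 0) :
    Tendsto (fun R => partialPrincipalPart (fun z => (E z)⁻¹) R s)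
      (admissibleRadii fun z => (E z)⁻¹)
      (𝓝 ((E s)⁻¹ - lineCauchy (fun t => (E (σ + t * I))⁻¹) σ s)) := by
  unfold admissibleRadii
  simp only [hE.isPole_iff]
  -- Convergence along the supremum of filters means convergence for each `δ`, to a limit that does
  -- not depend on `δ`.
  refine tendsto_iSup.mpr fun ⟨δ, hδ⟩ => ?_
  obtain ⟨C, hC⟩ := hE.bound δ hδ σ hσ
  set Φ : ℝ → ℂ := fun R => I * ∫ t : ℝ in -R..R, (E (σ + t * I))⁻¹ * (1 / (σ + t * I - s)) with hΦ
  have hΦlim : Tendsto Φ atTop (𝓝 (I * ∫ t : ℝ, (E (σ + t * I))⁻¹ * (1 / (σ + t * I - s)))) :=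
    (MeasureTheory.intervalIntegral_tendsto_integral (hE.integrable_line hσ hs)
      tendsto_neg_atTop_atBot tendsto_id).const_mul I
  set Ψ : ℝ → ℂ := fun R =>
    rectIntegral (fun z => (E z)⁻¹ * (1 / (z - s))) (-R) σ (-R) R with hΨ
  have hdiff : Tendsto (fun R => Ψ R - Φ R) (atTop ⊓ 𝓟 (goodRadii E δ)) (𝓝 0) := by
    have hz : Tendsto (fun R : ℝ => (4 * C * Real.exp σ + 4 * C) / R)
        (atTop ⊓ 𝓟 (goodRadii E δ)) (𝓝 0) :=
      (tendsto_const_nhds.div_atTop tendsto_id).mono_left inf_le_left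
    refine squeeze_zero_norm' ?_ hz
    rw [eventually_inf_principal]
    filter_upwards [hC, eventually_gt_atTop 0, eventually_ge_atTop (2 * ‖s‖)] with R h1 h2 h3 h4
    exact norm_rectIntegral_sub_le hσ h2 h3 (h1 h4)
  have hΨlim : Tendsto Ψ (atTop ⊓ 𝓟 (goodRadii E δ))
      (𝓝 (I * ∫ t : ℝ, (E (σ + t * I))⁻¹ * (1 / (σ + t * I - s)))) := by
    simpa using hdiff.add (hΦlim.mono_left inf_le_left)
  have hfin := (hΨlim.const_mul (1 / (2 * (Real.pi : ℂ) * I))).const_sub (E s)⁻¹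
  have hval : 1 / (2 * (Real.pi : ℂ) * I) *
      (I * ∫ t : ℝ, (E (σ + t * I))⁻¹ * (1 / (σ + t * I - s))) =
      lineCauchy (fun t => (E (σ + t * I))⁻¹) σ s := by
    unfold lineCauchy
    rw [MeasureTheory.integral_mul_const]
    ring
  rw [hval] at hfin
  refine hfin.congr' ?_
  rw [eventuallyEq_inf_principal_iff]
  filter_upwards [eventually_gt_atTop ‖s‖] with R h1 h2
  have hne : (2 * (Real.pi : ℂ) * I) ≠ 0 := by simp [Real.pi_ne_zero]
  rw [hΨ]
  simp only [hE.rectIntegral_eq hδ hσ h2 hs0 hs h1]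
  field_simp
  ring

lemma admissibleRadii_neBot (hE : HasDecayingReciprocal E) :
    (admissibleRadii fun z => (E z)⁻¹).NeBot := by
  obtain ⟨δ, hδ, h⟩ := hE.radii
  unfold admissibleRadii
  simp only [hE.isPole_iff]
  refine NeBot.mono ?_ (le_iSup _ ⟨δ, hδ⟩)
  exact frequently_mem_iff_neBot.mp h

lemma sub_principalPart_eq (hE : HasDecayingReciprocal E) {σ : ℝ} {s : ℂ} (hσ : 0 < σ)
    (hs : s.re < σ) (hs0 : E s ≠ 0) :
    (E s)⁻¹ - principalPart (fun z => (E z)⁻¹) s =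
      lineCauchy (fun t => (E (σ + t * I))⁻¹) σ s := by
  have := hE.admissibleRadii_neBot
  rw [principalPart, (hE.tendsto_partialPrincipalPart hσ hs hs0).limUnder_eq]
  ring

/-- The regular part is a Cauchy integral along a vertical line to the right. -/
lemma regularPart_eventuallyEq (hE : HasDecayingReciprocal E) {σ : ℝ} {s : ℂ} (hσ : 0 < σ)
    (hs : s.re < σ) :
    regularPart (fun z => (E z)⁻¹) =ᶠ[𝓝 s] lineCauchy (fun t => (E (σ + t * I))⁻¹) σ := by
  obtain ⟨C, hC⟩ := hE.vertical σ hσ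
  have hopen : {w : ℂ | w.re < σ} ∈ 𝓝 s := (isOpen_lt continuous_re continuous_const).mem_nhds hs
  refine limUnder_nhdsNE_eventuallyEq ?_ ?_
  · rw [analyticAt_iff_eventually_differentiableAt]
    filter_upwards [hopen] with w hw
    exact differentiableAt_lineCauchy hσ (hE.continuous_line hσ) hC hw
  · filter_upwards [nhdsWithin_le_nhds hopen, hE.eventually_ne_zero s] with w hw hw0
    exact hE.sub_principalPart_eq hσ hw hw0

lemma regularPart_eq (hE : HasDecayingReciprocal E) {σ : ℝ} {s : ℂ} (hσ : 0 < σ)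
    (hs : s.re < σ) :
    regularPart (fun z => (E z)⁻¹) s = lineCauchy (fun t => (E (σ + t * I))⁻¹) σ s :=
  (hE.regularPart_eventuallyEq hσ hs).self_of_nhds

lemma hasRegularPart (hE : HasDecayingReciprocal E) : HasRegularPart fun z => (E z)⁻¹ := by
  -- The regular part does not mention the line, so each point may use its own abscissa to its
  -- right.
  have hσ : ∀ s : ℂ, 0 < max s.re 0 + 1 ∧ s.re < max s.re 0 + 1 := fun s =>
    ⟨by linarith [le_max_right s.re 0], by linarith [le_max_left s.re 0]⟩
  refine ⟨hE.admissibleRadii_neBot, fun s hs => ?_, fun s hs => ?_, fun s => ?_⟩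
  · rw [hE.isPole_iff] at hs
    have h := hE.tendsto_partialPrincipalPart (hσ s).1 (hσ s).2 hs
    rw [← hE.sub_principalPart_eq (hσ s).1 (hσ s).2 hs, sub_sub_cancel] at h
    exact h
  · rw [hE.isPole_iff] at hs
    rw [hE.regularPart_eq (hσ s).1 (hσ s).2, hE.sub_principalPart_eq (hσ s).1 (hσ s).2 hs]
  · obtain ⟨C, hC⟩ := hE.vertical _ (hσ s).1
    exact (differentiableAt_lineCauchy (hσ s).1 (hE.continuous_line (hσ s).1) hC
      (hσ s).2).congr_of_eventuallyEq (hE.regularPart_eventuallyEq (hσ s).1 (hσ s).2)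

end HasDecayingReciprocal

end regular

/-! ### Bounds for the gamma function -/

section gamma

lemma norm_Gamma_le_Gamma_re {w : ℂ} (hw : 0 < w.re) : ‖Gamma w‖ ≤ Real.Gamma w.re := by
  rw [Gamma_eq_integral hw, Real.Gamma_eq_integral hw, GammaIntegral]
  refine (MeasureTheory.norm_integral_le_integral_norm _).trans_eq ?_
  refine MeasureTheory.setIntegral_congr_fun measurableSet_Ioi fun x hx => ?_
  simp only [norm_mul, norm_real, Real.norm_eq_abs, Real.abs_exp,
    norm_cpow_eq_rpow_re_of_pos (Set.mem_Ioi.mp hx), sub_re, one_re]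

lemma norm_Gamma_eq_div {w : ℂ} (hw : w ≠ 0) : ‖Gamma w‖ = ‖Gamma (w + 1)‖ / ‖w‖ := by
  rw [Gamma_add_one w hw, norm_mul, mul_div_cancel_left₀ _ (norm_ne_zero_iff.mpr hw)]

/-- One use of `Γ (w + 1) = w * Γ w` gains a factor `1 / ‖w‖`. Together with the Cauchy kernel this
makes integrals along vertical lines converge absolutely, so Stirling is not needed. -/
lemma norm_Gamma_le_div_norm {w : ℂ} (hw : 0 < w.re) :
    ‖Gamma w‖ ≤ Real.Gamma (w.re + 1) / ‖w‖ := by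
  rw [norm_Gamma_eq_div (by rintro rfl; simp at hw)]
  gcongr
  simpa using norm_Gamma_le_Gamma_re (w := w + 1) (by simp; linarith)

lemma exists_norm_Gamma_le_of_one_le_re (B : ℝ) :
    ∃ M : ℝ, 0 < M ∧ ∀ w : ℂ, 1 ≤ w.re → w.re ≤ B → ‖Gamma w‖ ≤ M := by
  have hc : ContinuousOn Real.Gamma (Set.Icc 1 B) := fun x hx =>
    (Real.differentiableAt_Gamma fun m h => by
      have := hx.1
      rw [h] at this
      have := Nat.cast_nonneg (α := ℝ) m
      linarith).continuousAt.continuousWithinAt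
  obtain ⟨M, hM⟩ := isCompact_Icc.exists_bound_of_continuousOn hc
  refine ⟨max M 1, by positivity, fun w h1 h2 => ?_⟩
  exact (norm_Gamma_le_Gamma_re (by linarith)).trans
    ((le_abs_self _).trans ((hM w.re ⟨h1, h2⟩).trans (le_max_left _ _)))

/-- Each shift `Γ w = Γ (w + 1) / w` costs at most `1 / δ`, and at most `n` shifts reach `1 ≤ re w`.
-/
lemma norm_Gamma_le_pow {B M δ : ℝ} (hB : 2 ≤ B) (hM : 0 < M)
    (h : ∀ w : ℂ, 1 ≤ w.re → w.re ≤ B → ‖Gamma w‖ ≤ M) (hδ : 0 < δ) (hδ1 : δ ≤ 1) (n : ℕ) :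
    ∀ w : ℂ, 1 - n ≤ w.re → w.re ≤ B → (∀ m : ℕ, δ ≤ ‖w + m‖) → ‖Gamma w‖ ≤ M * (1 / δ) ^ n := by
  have hone : 1 ≤ 1 / δ := (one_le_div hδ).mpr hδ1
  induction n with
  | zero => intro w h1 h2 _; simpa using h w (by simpa using h1) h2
  | succ n ih =>
    intro w h1 h2 h3
    by_cases hw : 1 ≤ w.re
    · exact (h w hw h2).trans (le_mul_of_one_le_right hM.le (one_le_pow₀ hone))
    · have hw0 : δ ≤ ‖w‖ := by simpa using h3 0
      rw [norm_Gamma_eq_div (norm_pos_iff.mp (hδ.trans_le hw0)), pow_succ, ← mul_assoc,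
        div_eq_mul_one_div]
      push_cast at h1
      have h4 := ih (w + 1) (by simp; linarith) (by simp; linarith) fun m => by
        have := h3 (m + 1)
        push_cast at this
        rwa [add_assoc, add_comm (1 : ℂ)]
      exact mul_le_mul h4 (one_div_le_one_div_of_le hδ hw0) (by positivity) (by positivity)

/-- Away from its poles, `Γ` decays faster than any exponential to the left. -/
lemma exists_norm_Gamma_le_exp (A B : ℝ) {δ : ℝ} (hA : 0 ≤ A) (hδ : 0 < δ) :
    ∃ C : ℝ, 0 ≤ C ∧ ∀ w : ℂ, w.re ≤ B → (∀ m : ℕ, δ ≤ ‖w + m‖) →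
      ‖Gamma w‖ ≤ C * Real.exp (A * w.re) := by
  obtain ⟨M, hM, hMb⟩ := exists_norm_Gamma_le_of_one_le_re (max B 2)
  -- Left of `-K` each shift divides by `‖w‖ ≥ K ≥ exp A`, which is the loss in `exp (A * re w)` per
  -- unit step.
  obtain ⟨K, hK⟩ := exists_nat_ge (Real.exp A)
  have hδ' : 0 < min δ 1 := lt_min hδ one_pos
  set D := M * (1 / min δ 1) ^ (K + 1) with hD
  have hD0 : 0 < D := by positivity
  have hbase : ∀ w : ℂ, -(K : ℝ) ≤ w.re → w.re ≤ max B 2 → (∀ m : ℕ, δ ≤ ‖w + m‖) →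
      ‖Gamma w‖ ≤ D * Real.exp (A * K) * Real.exp (A * w.re) := by
    intro w h1 h2 h3
    refine (norm_Gamma_le_pow (le_max_right _ _) hM hMb hδ' (min_le_right _ _) (K + 1) w
      (by push_cast; linarith) h2 fun m => (min_le_left _ _).trans (h3 m)).trans ?_
    rw [mul_assoc, ← Real.exp_add]
    exact le_mul_of_one_le_right hD0.le (Real.one_le_exp (by nlinarith))
  have hstep : ∀ n : ℕ, ∀ w : ℂ, -(K : ℝ) - n ≤ w.re → w.re ≤ max B 2 →
      (∀ m : ℕ, δ ≤ ‖w + m‖) →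
      ‖Gamma w‖ ≤ D * Real.exp (A * K) * Real.exp (A * w.re) := by
    intro n
    induction n with
    | zero => exact fun w h1 => hbase w (by simpa using h1)
    | succ n ih =>
      intro w h1 h2 h3
      by_cases hw : -(K : ℝ) ≤ w.re
      · exact hbase w hw h2 h3
      · have hw0 : δ ≤ ‖w‖ := by simpa using h3 0
        push_cast at h1
        have hK0 := Nat.cast_nonneg (α := ℝ) K
        have h4 := ih (w + 1) (by simp; linarith)
          (by rw [add_re, one_re]; linarith [le_max_right B 2]) fun m => by
            have := h3 (m + 1)
            push_cast at this
            rwa [add_assoc, add_comm (1 : ℂ)]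
        have h5 : Real.exp A ≤ ‖w‖ := by
          have := abs_re_le_norm w
          rw [abs_of_neg (by linarith)] at this
          linarith
        rw [norm_Gamma_eq_div (norm_pos_iff.mp (hδ.trans_le hw0)),
          div_le_iff₀ (hδ.trans_le hw0)]
        refine h4.trans ?_
        rw [add_re, one_re, mul_add, mul_one, Real.exp_add, ← mul_assoc]
        exact mul_le_mul_of_nonneg_left h5 (by positivity)
  refine ⟨D * Real.exp (A * K), by positivity, fun w hw h3 => ?_⟩
  obtain ⟨n, hn⟩ := exists_nat_ge (-(K : ℝ) - w.re)
  exact hstep n w (by linarith) (hw.trans (le_max_left _ _)) h3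

end gamma

/-! ### Sets of real numbers with gaps -/

section gaps

/-- `S` leaves a gap, of length bounded below, in every interval of a given length. -/
def HasGaps (S : Set ℝ) : Prop :=
  ∀ ℓ > 0, ∃ ℓ' > 0, ∀ x, ∃ y, x ≤ y ∧ y + ℓ' ≤ x + ℓ ∧ ∀ z ∈ S, z ∉ Set.Icc y (y + ℓ')

/-- A gap of `T` is found inside a gap of `S`. This is why `HasGaps` asks for gaps in intervals of
every length. -/
lemma HasGaps.union {S T : Set ℝ} (hS : HasGaps S) (hT : HasGaps T) : HasGaps (S ∪ T) := by
  intro ℓ hℓ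
  obtain ⟨ℓ₁, h1, hS⟩ := hS ℓ hℓ
  obtain ⟨ℓ₂, h2, hT⟩ := hT ℓ₁ h1
  refine ⟨ℓ₂, h2, fun x => ?_⟩
  obtain ⟨y, hy1, hy2, hy3⟩ := hS x
  obtain ⟨w, hw1, hw2, hw3⟩ := hT y
  refine ⟨w, hy1.trans hw1, hw2.trans hy2, ?_⟩
  rintro z (hz | hz)
  · exact fun h => hy3 z hz ⟨hw1.trans h.1, h.2.trans hw2⟩
  · exact hw3 z hz

lemma HasGaps.biUnion {ι : Type*} (s : Finset ι) {S : ι → Set ℝ} (h : ∀ i ∈ s, HasGaps (S i)) :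
    HasGaps {x | ∃ i ∈ s, x ∈ S i} := by
  classical
  induction s using Finset.induction_on with
  | empty => exact fun ℓ hℓ => ⟨ℓ, hℓ, fun x => ⟨x, le_rfl, le_rfl, by simp⟩⟩
  | insert i s _ ih =>
    have := (h i (Finset.mem_insert_self _ _)).union
      (ih fun j hj => h j (Finset.mem_insert_of_mem hj))
    convert this using 1
    ext x
    simp

/-- An interval of length `m ≤ d / 2` holds at most one point of `S`, so its first or its last third
is free. -/
lemma hasGaps_of_separated {S : Set ℝ} {d : ℝ} (hd : 0 < d)
    (h : ∀ x ∈ S, ∀ y ∈ S, |x - y| < d → x = y) : HasGaps S := by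
  intro ℓ hℓ
  set m := min ℓ (d / 2) with hm
  have hm0 : 0 < m := lt_min hℓ (by linarith)
  have hm1 : m ≤ ℓ := min_le_left _ _
  have hm2 : m ≤ d / 2 := min_le_right _ _
  refine ⟨m / 3, by positivity, fun x => ?_⟩
  by_cases hx : ∃ z ∈ S, z ∈ Set.Icc x (x + m / 3)
  · obtain ⟨z, hz, hzx⟩ := hx
    refine ⟨x + 2 * m / 3, by linarith, by linarith, fun w hw hwx => ?_⟩
    have h1 := hzx.1
    have h2 := hzx.2
    have h3 := hwx.1
    have h4 := hwx.2
    have := h z hz w hw (abs_lt.mpr ⟨by linarith, by linarith⟩)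
    linarith
  · push Not at hx
    exact ⟨x, le_rfl, by linarith, hx⟩

lemma HasGaps.exists_frequently {S : Set ℝ} (h : HasGaps S) :
    ∃ δ : ℝ, 0 < δ ∧ ∃ᶠ R : ℝ in atTop, ∀ z ∈ S, δ ≤ |R - z| := by
  obtain ⟨ℓ, hℓ, h⟩ := h 1 one_pos
  refine ⟨ℓ / 2, by positivity, frequently_atTop.mpr fun x => ?_⟩
  obtain ⟨y, hy1, -, hy3⟩ := h x
  refine ⟨y + ℓ / 2, by linarith, fun z hz => ?_⟩
  by_contra hlt
  rw [not_le, abs_lt] at hlt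
  exact hy3 z hz ⟨by linarith, by linarith⟩

end gaps

/-! ### Euler factors -/

section euler

/-- The reciprocal `1 - a p ^ (-z)` of an Euler factor. -/
def eulerFactor (a : ℂ) (p : ℕ) (z : ℂ) : ℂ := 1 - a / (p : ℂ) ^ z

variable {a : ℂ} {p : ℕ}

lemma natCast_cpow_eq_exp (hp : 2 ≤ p) (z : ℂ) : (p : ℂ) ^ z = exp (Real.log p * z) := by
  rw [cpow_def_of_ne_zero (by simp; omega), natCast_log]

lemma log_natCast_pos (hp : 2 ≤ p) : 0 < Real.log p := Real.log_pos (by exact_mod_cast hp)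

lemma differentiable_eulerFactor (hp : 2 ≤ p) : Differentiable ℂ (eulerFactor a p) := by
  unfold eulerFactor
  simp only [natCast_cpow_eq_exp hp]
  exact (differentiable_const _).sub ((differentiable_const _).div (by fun_prop)
    fun z => exp_ne_zero _)

lemma norm_div_cpow (hp : 2 ≤ p) (a z : ℂ) :
    ‖a / (p : ℂ) ^ z‖ = ‖a‖ * Real.exp (-(Real.log p * z.re)) := by
  rw [norm_div, natCast_cpow_eq_exp hp, norm_exp, re_ofReal_mul, Real.exp_neg, div_eq_mul_inv]

lemma re_eq_zero_of_eulerFactor_eq_zero (hp : 2 ≤ p) (ha : a = 0 ∨ ‖a‖ = 1) {z : ℂ}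
    (h : eulerFactor a p z = 0) : ‖a‖ = 1 ∧ z.re = 0 := by
  have h1 : a / (p : ℂ) ^ z = 1 := (sub_eq_zero.mp h).symm
  have ha1 : ‖a‖ = 1 := ha.resolve_left fun h0 => by simp [h0] at h1
  have h2 := norm_div_cpow hp a z
  rw [h1, ha1, norm_one, one_mul, eq_comm, Real.exp_eq_one_iff] at h2
  exact ⟨ha1, by simpa [(log_natCast_pos hp).ne'] using h2⟩

/-- Two zeros differ by a period of `p ^ z`, a multiple of `2 * π * I / log p`. -/
lemma eulerFactor_zeros_separated (hp : 2 ≤ p) {y y' : ℝ}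
    (hy : eulerFactor a p (y * I) = 0) (hy' : eulerFactor a p (y' * I) = 0)
    (h : |y - y'| < 2 * Real.pi / Real.log p) : y = y' := by
  have hL := log_natCast_pos hp
  have h1 : a / (p : ℂ) ^ (y * I : ℂ) = a / (p : ℂ) ^ (y' * I : ℂ) :=
    (sub_eq_zero.mp hy).symm.trans (sub_eq_zero.mp hy')
  have ha : a ≠ 0 := fun h0 => by simp [eulerFactor, h0] at hy
  have h2 : exp (Real.log p * (y * I)) = exp (Real.log p * (y' * I)) := by
    rw [← natCast_cpow_eq_exp hp, ← natCast_cpow_eq_exp hp]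
    simpa [div_eq_mul_inv, ha] using h1
  obtain ⟨n, hn⟩ := exp_eq_exp_iff_exists_int.mp h2
  have h3 := congrArg im hn
  simp only [mul_im, ofReal_re, ofReal_im, I_im, I_re, mul_re, add_im, intCast_re, intCast_im,
    re_ofNat, im_ofNat, mul_zero, mul_one, zero_mul, add_zero, sub_zero] at h3
  have h4 : y - y' = n * (2 * Real.pi / Real.log p) := by
    field_simp
    linarith
  rw [h4, abs_mul, abs_of_pos (by positivity : 0 < 2 * Real.pi / Real.log p)] at h
  have h5 : |(n : ℝ)| < 1 := by
    by_contra hge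
    exact h.not_ge (le_mul_of_one_le_left (by positivity) (not_lt.mp hge))
  have h6 : n = 0 := by
    rw [← Int.cast_abs] at h5
    exact Int.abs_lt_one_iff.mp (by exact_mod_cast h5)
  simp [h6] at h4
  linarith

/-- Reduces lower bounds for an Euler factor to the imaginary axis: moving `z` horizontally only
rescales `a / p ^ z`. -/
lemma norm_one_sub_le_two_mul (r : ℝ) {w : ℂ} (hw : ‖w‖ = 1) (hr : 0 ≤ r) :
    ‖1 - w‖ ≤ 2 * ‖1 - r * w‖ := by
  have h1 : |1 - r| ≤ ‖1 - r * w‖ := by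
    have := abs_norm_sub_norm_le (1 : ℂ) (r * w)
    simpa [hw, abs_of_nonneg hr] using this
  have h2 : ‖1 - w‖ ≤ ‖1 - r * w‖ + ‖(r * w - w : ℂ)‖ := by
    simpa using norm_add_le (1 - r * w) (r * w - w)
  have h3 : ‖(r * w - w : ℂ)‖ = |1 - r| := by
    rw [← sub_one_mul, norm_mul, hw, mul_one, ← ofReal_one, ← ofReal_sub, norm_real,
      Real.norm_eq_abs, abs_sub_comm]
  linarith

/-- With `w` the value of `a / p ^ z` at `z.im * I`, there is a zero at height `z.im + arg w / log
p`, so `|arg w| ≥ η * log p`; the chord `‖1 - w‖` is at least `2 / π` times the angle. The bound is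
uniform in `z.re`. -/
lemma le_norm_eulerFactor_of_im (hp : 2 ≤ p) (ha : ‖a‖ = 1) {η : ℝ} {z : ℂ}
    (h : ∀ y : ℝ, eulerFactor a p (y * I) = 0 → η ≤ |z.im - y|) :
    Real.log p * η / Real.pi ≤ ‖eulerFactor a p z‖ := by
  have hL := log_natCast_pos hp
  have hLc : (Real.log p : ℂ) ≠ 0 := by exact_mod_cast hL.ne'
  set w : ℂ := a / (p : ℂ) ^ (z.im * I : ℂ) with hwdef
  have hw : ‖w‖ = 1 := by rw [hwdef, norm_div_cpow hp, ha]; simp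
  have hsplit : a / (p : ℂ) ^ z = (Real.exp (-(Real.log p * z.re)) : ℝ) * w := by
    rw [hwdef, natCast_cpow_eq_exp hp, natCast_cpow_eq_exp hp, div_eq_mul_inv, div_eq_mul_inv,
      ← exp_neg, ← exp_neg, ofReal_exp, mul_left_comm, ← exp_add]
    congr 2
    conv_lhs => rw [← re_add_im z]
    push_cast
    ring
  have h1 := norm_one_sub_le_two_mul (Real.exp (-(Real.log p * z.re))) hw (Real.exp_pos _).le
  rw [← hsplit] at h1
  have hw0 : w ≠ 0 := norm_pos_iff.mp (hw ▸ one_pos)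
  have h2 := mul_angle_le_norm_sub (x := 1) (y := w) norm_one hw
  rw [angle_one_left hw0] at h2
  have hzero : eulerFactor a p ((z.im + w.arg / Real.log p : ℝ) * I) = 0 := by
    have hexp : exp (w.arg * I) = w := by simpa [hw] using norm_mul_exp_arg_mul_I w
    have hne : (p : ℂ) ^ (z.im * I : ℂ) ≠ 0 := by
      rw [natCast_cpow_eq_exp hp]
      exact exp_ne_zero _
    have : (p : ℂ) ^ ((z.im + w.arg / Real.log p : ℝ) * I : ℂ) = a := by
      rw [natCast_cpow_eq_exp hp]
      have h3 : (Real.log p * ((z.im + w.arg / Real.log p : ℝ) * I) : ℂ) =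
          Real.log p * (z.im * I) + w.arg * I := by
        simp only [ofReal_add, ofReal_div]
        field_simp
      rw [h3, exp_add, hexp, ← natCast_cpow_eq_exp hp, hwdef]
      field_simp
    rw [eulerFactor, this, div_self (norm_pos_iff.mp (ha ▸ one_pos)), sub_self]
  have h3 := h _ hzero
  rw [sub_add_cancel_left, abs_neg, abs_div, abs_of_pos hL, le_div_iff₀ hL] at h3
  have h4 : 2 / Real.pi * (η * Real.log p) ≤ 2 / Real.pi * |w.arg| :=
    mul_le_mul_of_nonneg_left h3 (by positivity)
  have h5 : Real.log p * η / Real.pi = (2 / Real.pi * (η * Real.log p)) / 2 := by ring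
  rw [h5, eulerFactor]
  linarith

lemma exists_le_norm_eulerFactor (hp : 2 ≤ p) (ha : a = 0 ∨ ‖a‖ = 1) {δ : ℝ} (hδ : 0 < δ) :
    ∃ c > 0, ∀ R ≥ 1, (∀ y : ℝ, eulerFactor a p (y * I) = 0 → δ ≤ |(R - |y|)|) →
      ∀ z : ℂ, (z.re = -R ∨ |z.im| = R) → c ≤ ‖eulerFactor a p z‖ := by
  have hL := log_natCast_pos hp
  rcases ha with rfl | ha
  · exact ⟨1, one_pos, fun R _ _ z _ => by simp [eulerFactor]⟩
  refine ⟨min 1 (Real.log p * δ / Real.pi), lt_min one_pos (by positivity), fun R hR h z hz => ?_⟩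
  rcases hz with hz | hz
  · refine (min_le_left _ _).trans ?_
    have h1 : 2 ≤ ‖a / (p : ℂ) ^ z‖ := by
      rw [norm_div_cpow hp, ha, one_mul, hz]
      have h2 : (2 : ℝ) ≤ p := by exact_mod_cast hp
      have h3 : Real.exp (Real.log p) = p := Real.exp_log (by linarith)
      calc (2 : ℝ) ≤ Real.exp (Real.log p) := by rw [h3]; exact h2
        _ ≤ _ := Real.exp_le_exp.mpr (by nlinarith)
    have := norm_sub_norm_le (a / (p : ℂ) ^ z) 1
    rw [norm_sub_rev] at this
    rw [eulerFactor]
    simp only [norm_one] at this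
    linarith
  · refine (min_le_right _ _).trans (le_norm_eulerFactor_of_im hp ha fun y hy => ?_)
    refine (h y hy).trans ?_
    rw [← hz]
    exact abs_abs_sub_abs_le _ _

lemma exists_le_norm_eulerFactor_of_re (hp : 2 ≤ p) (ha : a = 0 ∨ ‖a‖ = 1) {c : ℝ} (hc : 0 < c) :
    ∃ m > 0, ∀ z : ℂ, z.re = c → m ≤ ‖eulerFactor a p z‖ := by
  have hL := log_natCast_pos hp
  have hlt : Real.exp (-(Real.log p * c)) < 1 := by
    rw [← Real.exp_zero]
    exact Real.exp_lt_exp.mpr (neg_neg_of_pos (mul_pos hL hc))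
  refine ⟨1 - Real.exp (-(Real.log p * c)), sub_pos.mpr hlt, fun z hz => ?_⟩
  have h1 := norm_sub_norm_le 1 (a / (p : ℂ) ^ z)
  rw [norm_div_cpow hp, hz, norm_one] at h1
  have h2 : ‖a‖ ≤ 1 := by rcases ha with rfl | ha <;> simp [*]
  have := Real.exp_pos (-(Real.log p * c))
  rw [eulerFactor]
  nlinarith

end euler

/-! ### The reciprocal of the completed truncated Euler product -/

section truncated

lemma exists_le_norm_prod {ι α : Type*} (s : Finset ι) (f : ι → α → ℂ) (A : Set α)
    (h : ∀ i ∈ s, ∃ c > 0, ∀ x ∈ A, c ≤ ‖f i x‖) :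
    ∃ c > 0, ∀ x ∈ A, c ≤ ‖∏ i ∈ s, f i x‖ := by
  choose! c hc hcf using h
  refine ⟨∏ i ∈ s, c i, Finset.prod_pos hc, fun x hx => ?_⟩
  rw [norm_prod]
  exact Finset.prod_le_prod (fun i hi => (hc i hi).le) fun i hi => hcf i hi x hx

lemma HasGaps.mono {S T : Set ℝ} (hT : HasGaps T) (h : S ⊆ T) : HasGaps S := by
  intro ℓ hℓ
  obtain ⟨ℓ', h1, h2⟩ := hT ℓ hℓ
  refine ⟨ℓ', h1, fun x => ?_⟩
  obtain ⟨y, hy1, hy2, hy3⟩ := h2 x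
  exact ⟨y, hy1, hy2, fun z hz => hy3 z (h hz)⟩

variable {q : ℕ} (χ : DirichletCharacter ℂ q) (u : ℝ)

lemma apply_eq_zero_or_norm_eq_one (a : ZMod q) : χ a = 0 ∨ ‖χ a‖ = 1 := by
  by_cases ha : IsUnit a
  · obtain ⟨v, rfl⟩ := ha
    exact Or.inr (χ.unit_norm_eq_one v)
  · exact Or.inl (χ.map_nonunit ha)

lemma exists_kappa_eq : ∃ k : ℝ, 0 ≤ k ∧ k ≤ 1 ∧ kappa χ = k := by
  unfold kappa
  split_ifs
  · exact ⟨0, by simp⟩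
  · exact ⟨1, by simp⟩

/-- The product of the reciprocals of the Euler factors at the primes `p ≤ u`. -/
def eulerProd (z : ℂ) : ℂ := ∏ p ∈ Nat.primesLE ⌊u⌋₊, eulerFactor (χ (p : ZMod q)) p z

/-- The reciprocal of `truncXi χ u`, an entire function. -/
def truncXiInv (z : ℂ) : ℂ :=
  ((q : ℂ) / (Real.pi : ℂ)) ^ (-((z + kappa χ) / 2)) * (Gamma ((z + kappa χ) / 2))⁻¹ *
    eulerProd χ u z

variable {χ u} in
lemma two_le_of_mem {p : ℕ} (hp : p ∈ Nat.primesLE ⌊u⌋₊) : 2 ≤ p :=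
  (Nat.prime_of_mem_primesLE hp).two_le

lemma truncL_eq : truncL χ u = fun z => (eulerProd χ u z)⁻¹ := by
  funext z
  simp [truncL, eulerProd, eulerFactor, Finset.prod_inv_distrib]

/-- Equality holds even at the poles, where the conventions `Gamma (-n) = 0` and `0⁻¹ = 0` make both
sides zero. -/
lemma truncXi_eq : truncXi χ u = fun z => (truncXiInv χ u z)⁻¹ := by
  funext z
  simp only [truncXi, gFactor, truncL_eq, truncXiInv, mul_inv, inv_inv, cpow_neg]

lemma differentiable_eulerProd : Differentiable ℂ (eulerProd χ u) := by
  unfold eulerProd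
  exact Differentiable.fun_finsetProd fun p hp => differentiable_eulerFactor (two_le_of_mem hp)

lemma exists_le_norm_eulerProd_of_re {c : ℝ} (hc : 0 < c) :
    ∃ m > 0, ∀ z : ℂ, z.re = c → m ≤ ‖eulerProd χ u z‖ :=
  exists_le_norm_prod _ (fun p : ℕ => eulerFactor (χ (p : ZMod q)) p) {z | z.re = c} fun _ hp =>
    exists_le_norm_eulerFactor_of_re (two_le_of_mem hp) (apply_eq_zero_or_norm_eq_one χ _) hc

variable [NeZero q]

lemma div_pi_pos : 0 < (q : ℝ) / Real.pi :=
  div_pos (Nat.cast_pos.mpr (Nat.pos_of_ne_zero (NeZero.ne q))) Real.pi_pos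

lemma div_pi_cpow_eq_exp (w : ℂ) :
    ((q : ℂ) / (Real.pi : ℂ)) ^ w = exp (Real.log (q / Real.pi) * w) := by
  have h : ((q : ℂ) / (Real.pi : ℂ)) = ((q / Real.pi : ℝ) : ℂ) := by push_cast; rfl
  rw [h, cpow_def_of_ne_zero (by exact_mod_cast div_pi_pos.ne'), ofReal_log div_pi_pos.le]

lemma differentiable_truncXiInv : Differentiable ℂ (truncXiInv χ u) := by
  unfold truncXiInv
  simp only [div_pi_cpow_eq_exp]
  refine Differentiable.mul (Differentiable.mul (by fun_prop) ?_) (differentiable_eulerProd χ u)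
  exact differentiable_one_div_Gamma.comp (by fun_prop)

lemma truncXiInv_eq_zero_iff {z : ℂ} :
    truncXiInv χ u z = 0 ↔ (∃ m : ℕ, z = -(kappa χ + 2 * m)) ∨
      ∃ p ∈ Nat.primesLE ⌊u⌋₊, eulerFactor (χ (p : ZMod q)) p z = 0 := by
  rw [truncXiInv, div_pi_cpow_eq_exp, mul_eq_zero, mul_eq_zero, inv_eq_zero, Gamma_eq_zero_iff,
    eulerProd, Finset.prod_eq_zero_iff]
  refine or_congr ?_ Iff.rfl
  simp only [exp_ne_zero, false_or]
  refine exists_congr fun m => ⟨fun h => ?_, fun h => ?_⟩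
  · linear_combination 2 * h
  · linear_combination h / 2

lemma norm_gammaZero {k : ℝ} (hk : 0 ≤ k) (m : ℕ) : ‖(-(k + 2 * m) : ℂ)‖ = k + 2 * m := by
  have : (-(k + 2 * m) : ℂ) = ((-(k + 2 * m) : ℝ) : ℂ) := by push_cast; rfl
  rw [this, norm_real, Real.norm_eq_abs, abs_neg, abs_of_nonneg (by positivity)]

lemma truncXiInv_zeros {ρ : ℂ} (h : truncXiInv χ u ρ = 0) : ρ.re ≤ 0 ∧ (ρ.re = 0 ∨ ρ.im = 0) := by
  rcases (truncXiInv_eq_zero_iff χ u).mp h with ⟨m, rfl⟩ | ⟨p, hp, h⟩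
  · obtain ⟨k, hk0, -, hk⟩ := exists_kappa_eq χ
    simp only [hk]
    have : 0 ≤ k + 2 * (m : ℝ) := by positivity
    refine ⟨?_, Or.inr (by simp)⟩
    have h0 : (-(k + 2 * m) : ℂ).re = -(k + 2 * m) := by simp
    rw [h0]
    linarith
  · have := (re_eq_zero_of_eulerFactor_eq_zero (two_le_of_mem hp)
      (apply_eq_zero_or_norm_eq_one χ _) h).2
    exact ⟨this.le, Or.inl this⟩

lemma hasGaps_norm_eulerFactor_zeros {a : ℂ} {p : ℕ} (hp : 2 ≤ p) :
    HasGaps {x : ℝ | ∃ y : ℝ, eulerFactor a p (y * I) = 0 ∧ x = |y|} := by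
  have hd : 0 < 2 * Real.pi / Real.log p := div_pos (by positivity) (log_natCast_pos hp)
  have h1 : HasGaps {y : ℝ | eulerFactor a p (y * I) = 0} :=
    hasGaps_of_separated hd fun y hy y' hy' h => eulerFactor_zeros_separated hp hy hy' h
  have h2 : HasGaps {y : ℝ | eulerFactor a p ((-y : ℝ) * I) = 0} :=
    hasGaps_of_separated hd fun y hy y' hy' h =>
      neg_injective (eulerFactor_zeros_separated hp hy hy' (by
        rwa [neg_sub_neg, abs_sub_comm]))
  refine (h1.union h2).mono ?_
  rintro x ⟨y, hy, rfl⟩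
  rcases abs_choice y with h | h
  · left
    rwa [Set.mem_ofPred_eq, h]
  · right
    rwa [Set.mem_ofPred_eq, h, neg_neg]

lemma truncXiInv_radii :
    ∃ δ : ℝ, 0 < δ ∧ ∃ᶠ R : ℝ in atTop, ∀ ρ, truncXiInv χ u ρ = 0 → δ ≤ |R - ‖ρ‖| := by
  obtain ⟨k, hk0, -, hk⟩ := exists_kappa_eq χ
  have h1 : HasGaps {x : ℝ | ∃ m : ℕ, x = k + 2 * m} := by
    refine hasGaps_of_separated one_pos ?_
    rintro x ⟨m, rfl⟩ y ⟨n, rfl⟩ h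
    have h2 : |((m : ℤ) - n : ℝ)| < 1 := by
      rw [abs_lt] at h ⊢
      push_cast
      constructor <;> linarith
    have h3 : (m : ℤ) - n = 0 := Int.abs_lt_one_iff.mp (by exact_mod_cast h2)
    have h4 : m = n := by omega
    rw [h4]
  have h2 := HasGaps.biUnion (Nat.primesLE ⌊u⌋₊)
    (S := fun p => {x : ℝ | ∃ y : ℝ, eulerFactor (χ (p : ZMod q)) p (y * I) = 0 ∧ x = |y|})
    fun p hp => hasGaps_norm_eulerFactor_zeros (two_le_of_mem hp)
  obtain ⟨δ, hδ, hfr⟩ := (h1.union h2).exists_frequently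
  refine ⟨δ, hδ, hfr.mono fun R hR ρ hρ => hR _ ?_⟩
  rcases (truncXiInv_eq_zero_iff χ u).mp hρ with ⟨m, rfl⟩ | ⟨p, hp, h⟩
  · left
    exact ⟨m, by rw [hk, norm_gammaZero hk0]⟩
  · right
    have hre := (re_eq_zero_of_eulerFactor_eq_zero (two_le_of_mem hp)
      (apply_eq_zero_or_norm_eq_one χ _) h).2
    have hρI : (ρ.im * I : ℂ) = ρ := by
      conv_rhs => rw [← re_add_im ρ, hre]
      simp
    exact ⟨p, hp, ρ.im, by rwa [hρI], (abs_im_eq_norm.mpr hre).symm⟩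

lemma norm_div_pi_cpow (w : ℂ) :
    ‖((q : ℂ) / (Real.pi : ℂ)) ^ w‖ = Real.exp (Real.log (q / Real.pi) * w.re) := by
  rw [div_pi_cpow_eq_exp, norm_exp, re_ofReal_mul]

lemma exists_norm_le_on_line {c : ℝ} (hc : 0 < c) :
    (∃ C : ℝ, ∀ t : ℝ, ‖gFactor χ (c + t * I)‖ ≤ C / ‖(c + t * I : ℂ)‖) ∧
    ∃ C : ℝ, ∀ t : ℝ, ‖truncL χ u (c + t * I)‖ ≤ C := by
  constructor
  · obtain ⟨k, hk0, -, hk⟩ := exists_kappa_eq χ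
    refine ⟨Real.exp (Real.log (q / Real.pi) * ((c + k) / 2)) *
      (Real.Gamma ((c + k) / 2 + 1) * 2), fun t => ?_⟩
    have hre : (((c + t * I : ℂ) + k) / 2).re = (c + k) / 2 := by simp
    have hpos : 0 < (c + k) / 2 := by positivity
    have hz := line_norm_pos hc t
    -- In the right half plane, adding `k ≥ 0` only increases the norm.
    have h2 : ‖(c + t * I : ℂ)‖ / 2 ≤ ‖((c + t * I : ℂ) + k) / 2‖ := by
      rw [norm_div, norm_ofNat]
      gcongr
      rw [← sq_le_sq₀ (norm_nonneg _) (norm_nonneg _), Complex.sq_norm, Complex.sq_norm,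
        normSq_add_mul_I, add_right_comm, ← ofReal_add, normSq_add_mul_I]
      gcongr
      linarith
    have h1 := norm_Gamma_le_div_norm (w := ((c + t * I : ℂ) + k) / 2) (by rw [hre]; exact hpos)
    rw [hre] at h1
    have hG := Real.Gamma_pos_of_pos (add_pos hpos one_pos)
    have h3 : ‖Gamma (((c + t * I : ℂ) + k) / 2)‖ ≤
        Real.Gamma ((c + k) / 2 + 1) * 2 / ‖(c + t * I : ℂ)‖ := by
      refine h1.trans ?_
      rw [div_le_div_iff₀ (by linarith) hz, mul_assoc]
      exact mul_le_mul_of_nonneg_left (by linarith) hG.le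
    rw [gFactor, norm_mul, norm_div_pi_cpow, hk, hre, mul_div_assoc]
    gcongr
  · obtain ⟨m, hm, h⟩ := exists_le_norm_eulerProd_of_re χ u hc
    refine ⟨m⁻¹, fun t => ?_⟩
    rw [truncL_eq, norm_inv]
    exact inv_anti₀ hm (h _ (by simp))

lemma truncXiInv_bound {δ c : ℝ} (hδ : 0 < δ) (hc : 0 < c) :
    ∃ C : ℝ, ∀ᶠ R : ℝ in atTop, (∀ ρ, truncXiInv χ u ρ = 0 → δ ≤ |R - ‖ρ‖|) →
      ∀ z : ℂ, z.re ≤ c → (z.re = -R ∨ |z.im| = R) →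
        ‖(truncXiInv χ u z)⁻¹‖ ≤ C * Real.exp z.re := by
  obtain ⟨k, hk0, hk1, hk⟩ := exists_kappa_eq χ
  set lam : ℝ := Real.log (q / Real.pi) / 2 with hlam
  set δ' : ℝ := min δ 1 / 2 with hδ'
  -- The gamma argument is `(z + k) / 2`, so decay rate `2 * (1 + |lam|)` there is rate `1 + |lam|`
  -- in `z`: `|lam|` absorbs the power of `q / π` and `1` remains. Likewise the separation is
  -- halved.
  have hδ'0 : 0 < δ' := half_pos (lt_min hδ one_pos)
  obtain ⟨C, hC0, hC⟩ := exists_norm_Gamma_le_exp (2 * (1 + |lam|)) ((c + 1) / 2)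
    (by positivity) hδ'0
  obtain ⟨m, hm, hprod⟩ := exists_le_norm_prod (Nat.primesLE ⌊u⌋₊)
    -- Carrying the radius along with the point makes the lower bound uniform in `R`.
    (fun (p : ℕ) (x : ℝ × ℂ) => eulerFactor (χ (p : ZMod q)) p x.2)
    {x | 1 ≤ x.1 ∧ (∀ ρ, truncXiInv χ u ρ = 0 → δ ≤ |x.1 - ‖ρ‖|) ∧
      (x.2.re = -x.1 ∨ |x.2.im| = x.1)} fun p hp => by
    obtain ⟨b, hb, h⟩ := exists_le_norm_eulerFactor (two_le_of_mem hp)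
      (apply_eq_zero_or_norm_eq_one χ (p : ZMod q)) hδ
    refine ⟨b, hb, fun x hx => h x.1 hx.1 (fun y hy => ?_) x.2 hx.2.2⟩
    simpa using hx.2.1 (y * I) ((truncXiInv_eq_zero_iff χ u).mpr (Or.inr ⟨p, hp, hy⟩))
  refine ⟨Real.exp (|lam| * (2 * c + 1)) * (C * Real.exp (1 + |lam|)) * m⁻¹, ?_⟩
  filter_upwards [eventually_ge_atTop 1] with R hR hgood z hzc hz
  have hsep : ∀ n : ℕ, δ' ≤ ‖(z + k) / 2 + n‖ := by
    intro n
    have h1 : (z + k) / 2 + n = (z + k + 2 * n) / 2 := by ring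
    rw [h1, norm_div, norm_ofNat, hδ']
    gcongr
    rcases hz with hz | hz
    · refine (min_le_left _ _).trans ?_
      have h2 := hgood _ ((truncXiInv_eq_zero_iff χ u).mpr (Or.inl ⟨n, rfl⟩))
      rw [hk, norm_gammaZero hk0] at h2
      refine h2.trans ?_
      have h3 := abs_re_le_norm (z + k + 2 * n)
      have h4 : (z + k + 2 * n).re = -(R - (k + 2 * n)) := by simp [hz]; ring
      rwa [h4, abs_neg] at h3
    · refine (min_le_right _ _).trans (hR.trans ?_)
      rw [← hz]
      have h3 := abs_im_le_norm (z + k + 2 * n)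
      simpa using h3
  have hre : ((z + k) / 2).re = (z.re + k) / 2 := by simp
  have hG : ‖Gamma ((z + k) / 2)‖ ≤ C * Real.exp (1 + |lam|) * Real.exp ((1 + |lam|) * z.re) := by
    refine (hC _ (by rw [hre]; linarith) hsep).trans ?_
    rw [mul_assoc C, ← Real.exp_add, hre]
    refine mul_le_mul_of_nonneg_left (Real.exp_le_exp.mpr ?_) hC0
    have : 0 ≤ (1 + |lam|) * (1 - k) := mul_nonneg (by positivity) (by linarith)
    linarith
  have hq : ‖((q : ℂ) / (Real.pi : ℂ)) ^ ((z + k) / 2)‖ ≤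
      Real.exp (|lam| * (2 * c + 1)) * Real.exp (-(|lam| * z.re)) := by
    rw [norm_div_pi_cpow, hre, ← Real.exp_add]
    refine Real.exp_le_exp.mpr ?_
    have h1 : Real.log (q / Real.pi) * ((z.re + k) / 2) = lam * (z.re + k) := by
      rw [hlam]; ring
    have h2 : |z.re + k| ≤ 2 * c + 1 - z.re := abs_le.mpr ⟨by linarith, by linarith⟩
    calc _ = lam * (z.re + k) := h1
      _ ≤ |lam| * |z.re + k| := by rw [← abs_mul]; exact le_abs_self _
      _ ≤ |lam| * (2 * c + 1 - z.re) := by gcongr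
      _ = _ := by ring
  have hL : ‖(eulerProd χ u z)⁻¹‖ ≤ m⁻¹ := by
    rw [norm_inv]
    exact inv_anti₀ hm (hprod (R, z) ⟨hR, hgood, hz⟩)
  rw [← congrFun (truncXi_eq χ u) z, truncXi, gFactor, truncL_eq, norm_mul, norm_mul, hk]
  calc _ ≤ Real.exp (|lam| * (2 * c + 1)) * Real.exp (-(|lam| * z.re)) *
        (C * Real.exp (1 + |lam|) * Real.exp ((1 + |lam|) * z.re)) * m⁻¹ := by gcongr
    _ = Real.exp (|lam| * (2 * c + 1)) * (C * Real.exp (1 + |lam|)) * m⁻¹ *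
        (Real.exp (-(|lam| * z.re)) * Real.exp ((1 + |lam|) * z.re)) := by ring
    _ = _ := by
      rw [← Real.exp_add]
      ring_nf

lemma hasDecayingReciprocal_truncXiInv : HasDecayingReciprocal (truncXiInv χ u) where
  differentiable := differentiable_truncXiInv χ u
  ne_zero := ⟨1, fun h => by
    have := (truncXiInv_zeros χ u h).1
    norm_num at this⟩
  zeros ρ h := truncXiInv_zeros χ u h
  radii := truncXiInv_radii χ u
  bound δ hδ c hc := truncXiInv_bound χ u hδ hc
  vertical c hc := by
    obtain ⟨⟨C, hC⟩, C', hC'⟩ := exists_norm_le_on_line χ u hc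
    refine ⟨C * C', fun t => ?_⟩
    rw [← congrFun (truncXi_eq χ u) (c + t * I), truncXi, norm_mul, mul_div_right_comm]
    exact mul_le_mul (hC t) (hC' t) (norm_nonneg _) ((norm_nonneg _).trans (hC t))

end truncated

/-! ### The completed `L`-function in vertical strips -/

section strips

open MeasureTheory

/-- `f` is bounded on every closed vertical strip. -/
def BoundedOnStrips (f : ℂ → ℂ) : Prop :=
  ∀ a b : ℝ, ∃ C : ℝ, ∀ s : ℂ, a ≤ s.re → s.re ≤ b → ‖f s‖ ≤ C

namespace BoundedOnStrips

variable {f g : ℂ → ℂ}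

lemma const (c : ℂ) : BoundedOnStrips fun _ => c := fun _ _ => ⟨‖c‖, fun _ _ _ => le_rfl⟩

lemma add (hf : BoundedOnStrips f) (hg : BoundedOnStrips g) :
    BoundedOnStrips fun s => f s + g s := by
  intro a b
  obtain ⟨C, hC⟩ := hf a b
  obtain ⟨D, hD⟩ := hg a b
  exact ⟨C + D, fun s h1 h2 => (norm_add_le _ _).trans (add_le_add (hC s h1 h2) (hD s h1 h2))⟩

lemma mul (hf : BoundedOnStrips f) (hg : BoundedOnStrips g) :
    BoundedOnStrips fun s => f s * g s := by
  intro a b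
  obtain ⟨C, hC⟩ := hf a b
  obtain ⟨D, hD⟩ := hg a b
  refine ⟨C * D, fun s h1 h2 => ?_⟩
  rw [norm_mul]
  exact mul_le_mul (hC s h1 h2) (hD s h1 h2) (norm_nonneg _) ((norm_nonneg _).trans (hC s h1 h2))

lemma sum {ι : Type*} (s : Finset ι) {F : ι → ℂ → ℂ} (hF : ∀ i, BoundedOnStrips (F i)) :
    BoundedOnStrips fun z => ∑ i ∈ s, F i z := by
  classical
  induction s using Finset.induction_on with
  | empty => simpa using const 0
  | insert i s hi ih =>
    simp only [Finset.sum_insert hi]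
    exact (hF i).add ih

lemma comp_add_div_two (hf : BoundedOnStrips f) (c : ℂ) :
    BoundedOnStrips fun s => f ((s + c) / 2) := by
  intro a b
  obtain ⟨C, hC⟩ := hf ((a + c.re) / 2) ((b + c.re) / 2)
  have hre : ∀ s : ℂ, ((s + c) / 2).re = (s.re + c.re) / 2 := fun s => by simp
  exact ⟨C, fun s h1 h2 => hC _ (by rw [hre]; linarith) (by rw [hre]; linarith)⟩

lemma comp_neg (hf : BoundedOnStrips f) : BoundedOnStrips fun s => f (-s) := by
  intro a b
  obtain ⟨C, hC⟩ := hf (-b) (-a)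
  exact ⟨C, fun s h1 h2 => hC _ (by simpa using h2) (by simpa using h1)⟩

lemma natCast_cpow (N : ℕ) [NeZero N] : BoundedOnStrips fun s => (N : ℂ) ^ s := by
  intro a b
  have hN : 1 ≤ (N : ℝ) := by exact_mod_cast Nat.one_le_iff_ne_zero.mpr (NeZero.ne N)
  refine ⟨(N : ℝ) ^ b, fun s h1 h2 => ?_⟩
  rw [norm_natCast_cpow_of_pos (Nat.pos_of_ne_zero (NeZero.ne N))]
  exact Real.rpow_le_rpow_of_exponent_le hN h2

/-- The integrand's norm depends only on `re s`, and on the strip its power of `t` is at most the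
sum of the two powers at the edges. -/
lemma mellin {φ : ℝ → ℂ} (hφ : ∀ s, MellinConvergent φ s) : BoundedOnStrips (mellin φ) := by
  intro a b
  have hint : ∀ x : ℝ, IntegrableOn (fun t : ℝ => t ^ (x - 1) * ‖φ t‖) (Set.Ioi 0) := by
    intro x
    refine (integrableOn_congr_fun (fun t ht => ?_) measurableSet_Ioi).mp (hφ x).norm
    rw [norm_smul, norm_cpow_eq_rpow_re_of_pos (Set.mem_Ioi.mp ht)]
    simp
  refine ⟨∫ t in Set.Ioi (0 : ℝ), (t ^ (a - 1) * ‖φ t‖ + t ^ (b - 1) * ‖φ t‖),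
    fun s h1 h2 => ?_⟩
  refine norm_integral_le_of_norm_le ((hint a).add (hint b)) ?_
  filter_upwards [ae_restrict_mem measurableSet_Ioi] with t ht
  have ht0 : 0 < t := ht
  rw [norm_smul, norm_cpow_eq_rpow_re_of_pos ht0, ← add_mul, sub_re, one_re]
  gcongr
  rcases le_total 1 t with h | h
  · have := Real.rpow_le_rpow_of_exponent_le h (show s.re - 1 ≤ b - 1 by linarith)
    have := Real.rpow_nonneg ht0.le (a - 1)
    linarith
  · have := Real.rpow_le_rpow_of_exponent_ge ht0 h (show a - 1 ≤ s.re - 1 by linarith)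
    have := Real.rpow_nonneg ht0.le (b - 1)
    linarith

lemma completedHurwitzZetaEven₀ (a : UnitAddCircle) :
    BoundedOnStrips (HurwitzZeta.completedHurwitzZetaEven₀ a) := by
  have h : BoundedOnStrips (HurwitzZeta.hurwitzEvenFEPair a).Λ₀ :=
    mellin fun s =>
      ((HurwitzZeta.hurwitzEvenFEPair a).isStrongFEPair_toStrongFEPair.hasMellin s).1
  simpa [funext_iff, HurwitzZeta.completedHurwitzZetaEven₀, div_eq_mul_inv, BoundedOnStrips] using
    (h.comp_add_div_two 0).mul (const (2⁻¹ : ℂ))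

lemma completedHurwitzZetaOdd (a : UnitAddCircle) :
    BoundedOnStrips (HurwitzZeta.completedHurwitzZetaOdd a) := by
  have h : BoundedOnStrips (HurwitzZeta.hurwitzOddFEPair a).Λ := by
    rw [(HurwitzZeta.isStrong_hurwitzOddFEPair a).Λ_eq]
    exact mellin fun s => ((HurwitzZeta.isStrong_hurwitzOddFEPair a).hasMellin s).1
  simpa [funext_iff, HurwitzZeta.completedHurwitzZetaOdd, div_eq_mul_inv, BoundedOnStrips] using
    (h.comp_add_div_two 1).mul (const (2⁻¹ : ℂ))

end BoundedOnStrips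

variable {q : ℕ} [NeZero q] {χ : DirichletCharacter ℂ q}

/-- The polar terms of the completed `L`-function carry the factors `χ 0` and `∑ χ j`, both zero
here; what is left is a finite combination of everywhere convergent Mellin transforms. -/
lemma boundedOnStrips_xi (hχ : χ ≠ 1) : BoundedOnStrips (xi χ) := by
  have hq : q ≠ 1 := hχ ∘ DirichletCharacter.level_one' χ
  have h0 : BoundedOnStrips (ZMod.completedLFunction₀ χ) := by
    unfold ZMod.completedLFunction₀
    refine BoundedOnStrips.add ?_ ?_ <;>
      refine (BoundedOnStrips.natCast_cpow q).comp_neg.mul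
        (BoundedOnStrips.sum _ fun j => (BoundedOnStrips.const _).mul ?_)
    exacts [BoundedOnStrips.completedHurwitzZetaEven₀ _, BoundedOnStrips.completedHurwitzZetaOdd _]
  have h1 : DirichletCharacter.completedLFunction χ = ZMod.completedLFunction₀ χ := by
    funext s
    rw [DirichletCharacter.completedLFunction, ZMod.completedLFunction_eq, χ.map_zero' hq,
      χ.sum_eq_zero_of_ne_one hχ]
    simp
  unfold xi
  rw [h1]
  exact ((BoundedOnStrips.natCast_cpow q).comp_add_div_two (kappa χ)).mul h0

lemma differentiable_xi (hχ : χ ≠ 1) : Differentiable ℂ (xi χ) := by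
  unfold xi
  have hq : (q : ℂ) ≠ 0 := NeZero.ne _
  refine Differentiable.mul (fun s => ?_) (DirichletCharacter.differentiable_completedLFunction hχ)
  exact DifferentiableAt.const_cpow (by fun_prop) (Or.inl hq)

lemma inv_even_iff {q : ℕ} {χ : DirichletCharacter ℂ q} : χ⁻¹.Even ↔ χ.Even := by
  simp [DirichletCharacter.Even, MulChar.inv_apply_eq_inv]

lemma kappa_inv {q : ℕ} {χ : DirichletCharacter ℂ q} : kappa χ⁻¹ = kappa χ := by
  classical
  simp only [kappa, inv_even_iff]

lemma gFactor_inv {q : ℕ} {χ : DirichletCharacter ℂ q} : gFactor χ⁻¹ = gFactor χ := by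
  funext s
  simp only [gFactor, kappa_inv]

/-- The functional equation. -/
lemma xi_one_sub (hχ : χ.IsPrimitive) (s : ℂ) : xi χ (1 - s) = eps χ * xi χ⁻¹ s := by
  have hq : (q : ℂ) ≠ 0 := NeZero.ne _
  have h : (q : ℂ) ^ ((s + kappa χ) / 2) =
      (q : ℂ) ^ ((1 - s + kappa χ) / 2) * (q : ℂ) ^ (s - 1 / 2) := by
    rw [← cpow_add _ _ hq]
    congr 1
    ring
  rw [xi, xi, hχ.completedLFunction_one_sub, kappa_inv, eps_eq_rootNumber, h]
  ring

lemma xi_eq_of_re_pos (hχ : χ ≠ 1) {s : ℂ} (hs : 0 < s.re) :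
    xi χ s = gFactor χ s * DirichletCharacter.LFunction χ s := by
  obtain ⟨k, hk0, -, hk⟩ := exists_kappa_eq χ
  refine xi_eq_gFactor_mul_LFunction (hχ ∘ DirichletCharacter.level_one' χ) χ s fun n hn => ?_
  have := congrArg re hn
  rw [hk] at this
  simp at this
  have := Nat.cast_nonneg (α := ℝ) n
  linarith

lemma exists_norm_LFunction_le {σ : ℝ} (hσ : 1 < σ) :
    ∃ C : ℝ, ∀ t : ℝ, ‖DirichletCharacter.LFunction χ (σ + t * I)‖ ≤ C := by
  have hs : 1 < (σ : ℂ).re := by simpa using hσ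
  refine ⟨∑' n, ‖LSeries.term (fun n => χ n) σ n‖, fun t => ?_⟩
  rw [DirichletCharacter.LFunction_eq_LSeries χ (by simpa using hσ)]
  exact tsum_of_norm_bounded (ZMod.LSeriesSummable_of_one_lt_re χ hs).norm.hasSum fun n =>
    LSeries.norm_term_le_of_re_le_re _ (by simp) n

lemma exists_norm_xi_le (hχ : χ ≠ 1) {σ : ℝ} (hσ : 1 < σ) :
    ∃ C : ℝ, ∀ t : ℝ, ‖xi χ (σ + t * I)‖ ≤ C / ‖(σ + t * I : ℂ)‖ := by
  -- The cutoff `0` is a dummy: only the gamma factor's bound is used.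
  obtain ⟨C, hC⟩ := (exists_norm_le_on_line χ 0 (zero_lt_one.trans hσ)).1
  obtain ⟨D, hD⟩ := exists_norm_LFunction_le (χ := χ) hσ
  refine ⟨C * D, fun t => ?_⟩
  rw [xi_eq_of_re_pos hχ (by simp; linarith), norm_mul, mul_div_right_comm]
  exact mul_le_mul (hC t) (hD t) (norm_nonneg _) ((norm_nonneg _).trans (hC t))

lemma integrable_xi (hχ : χ ≠ 1) {σ : ℝ} (hσ : 1 < σ) {s : ℂ} (hs : s.re < σ) :
    Integrable fun t : ℝ => xi χ (σ + t * I) * (1 / (σ + t * I - s)) :=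
  have ⟨_, hC⟩ := exists_norm_xi_le hχ hσ
  integrable_lineCauchy (zero_lt_one.trans hσ)
    ((differentiable_xi hχ).continuous.comp (by fun_prop)) hC hs

lemma tendsto_horizontal_zero {F : ℂ → ℂ} (hF : BoundedOnStrips F) {a b : ℝ} (hab : a ≤ b) (s : ℂ)
    {h : ℝ → ℝ} (hh : ∀ T, |h T| = |T|) :
    Tendsto (fun T : ℝ => ∫ x : ℝ in a..b, F (x + h T * I) * (1 / (x + h T * I - s))) atTop
      (𝓝 0) := by
  obtain ⟨C, hC⟩ := hF a b
  have hlim : Tendsto (fun T : ℝ => C * 2 * |b - a| / T) atTop (𝓝 0) :=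
    tendsto_const_nhds.div_atTop tendsto_id
  refine squeeze_zero_norm' ?_ hlim
  filter_upwards [eventually_gt_atTop 0, eventually_ge_atTop (2 * ‖s‖)] with T h1 h2
  refine (intervalIntegral.norm_integral_le_of_norm_le_const (C := C * (2 / T))
    fun x hx => ?_).trans_eq (by ring)
  rw [Set.uIoc_of_le hab] at hx
  have h3 : T ≤ ‖(x + h T * I : ℂ)‖ := by
    have := abs_im_le_norm (x + h T * I : ℂ)
    simpa [hh, abs_of_pos h1] using this
  have h4 : T / 2 ≤ ‖(x + h T * I - s : ℂ)‖ := by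
    have := norm_sub_norm_le (x + h T * I : ℂ) s
    linarith
  have hCx := hC (x + h T * I) (by simpa using hx.1.le) (by simpa using hx.2)
  rw [norm_mul, norm_div, norm_one]
  refine mul_le_mul hCx ?_ (by positivity) ((norm_nonneg _).trans hCx)
  exact (one_div_le_one_div_of_le (by positivity) h4).trans_eq (by field_simp)

/-- The substitution `z ↦ 1 - z` carries the left side to the right one; the minus sign comes from
the kernel. -/
lemma left_side_eq (hχ : χ.IsPrimitive) (σ T : ℝ) (s : ℂ) :
    ∫ y : ℝ in -T..T, xi χ ((1 - σ : ℝ) + y * I) * (1 / ((1 - σ : ℝ) + y * I - s)) =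
      -(eps χ * ∫ t : ℝ in -T..T, xi χ⁻¹ (σ + t * I) * (1 / (σ + t * I - (1 - s)))) := by
  rw [← intervalIntegral.integral_const_mul, ← intervalIntegral.integral_neg]
  have := intervalIntegral.integral_comp_neg (a := -T) (b := T)
    fun y : ℝ => xi χ ((1 - σ : ℝ) + y * I) * (1 / ((1 - σ : ℝ) + y * I - s))
  rw [neg_neg] at this
  rw [← this]
  refine intervalIntegral.integral_congr fun y _ => ?_
  have h1 : (((1 - σ : ℝ) : ℂ) + ((-y : ℝ) : ℂ) * I) = 1 - (σ + y * I) := by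
    push_cast
    ring
  have h2 : (1 - (σ + y * I) - s : ℂ) = -(σ + y * I - (1 - s)) := by ring
  simp only [h1, h2, xi_one_sub hχ, one_div, inv_neg]
  ring

/-- `ξ` as the sum of the Cauchy integrals along the two sides of a vertical strip, the left one
moved to the right by the functional equation. -/
lemma xi_eq_lineCauchy (hχ : χ.IsPrimitive) (hχ1 : χ ≠ 1) {σ : ℝ} (hσ : 1 < σ) {s : ℂ}
    (hs : s.re < σ) (hs' : (1 - s).re < σ) :
    xi χ s = lineCauchy (fun t => xi χ (σ + t * I)) σ s +
      eps χ * lineCauchy (fun t => xi χ⁻¹ (σ + t * I)) σ (1 - s) := by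
  have hχ1' : χ⁻¹ ≠ 1 := inv_ne_one.mpr hχ1
  have hr := intervalIntegral_tendsto_integral (integrable_xi hχ1 hσ hs)
    tendsto_neg_atTop_atBot tendsto_id
  have hl := intervalIntegral_tendsto_integral (integrable_xi hχ1' hσ hs')
    tendsto_neg_atTop_atBot tendsto_id
  have hb := tendsto_horizontal_zero (boundedOnStrips_xi hχ1) (a := 1 - σ) (b := σ) (by linarith) s
    (h := fun T => -T) fun T => abs_neg T
  have ht := tendsto_horizontal_zero (boundedOnStrips_xi hχ1) (a := 1 - σ) (b := σ) (by linarith) s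
    (h := fun T => T) fun T => rfl
  have hall := ((hb.sub ht).add (hr.const_mul I)).add ((hl.const_mul (eps χ)).const_mul I)
  have hconst : Tendsto (fun _ : ℝ => 2 * Real.pi * I * xi χ s) atTop
      (𝓝 (2 * Real.pi * I * xi χ s)) := tendsto_const_nhds
  have heq := tendsto_nhds_unique_of_eventuallyEq hconst hall ?_
  · have hne : (2 * (Real.pi : ℂ) * I) ≠ 0 := by simp [Real.pi_ne_zero]
    unfold lineCauchy
    rw [integral_mul_const, integral_mul_const, ← mul_right_inj' hne, heq]
    field_simp
    ring
  · filter_upwards [eventually_gt_atTop ‖s‖] with T hT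
    have him := abs_lt.mp ((abs_im_le_norm s).trans_lt hT)
    have hin : InRect (1 - σ) σ (-T) T s := by
      refine ⟨?_, hs, him⟩
      rw [sub_re, one_re] at hs'
      linarith
    rw [← rectIntegral_cauchy hin fun z _ _ => differentiable_xi hχ1 z, rectIntegral,
      left_side_eq hχ]
    simp only [id]
    ring

end strips

end DirichletApprox

end

/-! ### Subtraction of the two Cauchy representations. -/

theorem theorem2 (q : ℕ) [NeZero q] (hq : 1 < q) (χ : DirichletCharacter ℂ q)
    (hχ : χ.IsPrimitive) (u : ℝ) (s₀ : ℂ) (σ : ℝ) (hσ : 1 < σ)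
    (hs₀ : s₀.re < σ) (hs₀' : (1 - s₀).re < σ) :
    (DirichletApprox.HasRegularPart (DirichletApprox.truncXi χ u) ∧
      DirichletApprox.HasRegularPart (DirichletApprox.truncXi χ⁻¹ u)) ∧
    MeasureTheory.Integrable
      (fun t : ℝ => DirichletApprox.errorIntegrand χ u s₀ ((σ : ℂ) + (t : ℂ) * Complex.I)) ∧
    DirichletApprox.xi χ s₀ - DirichletApprox.approxXi χ u s₀ =
      1 / (2 * (Real.pi : ℂ) * Complex.I) *
        ∫ t : ℝ, DirichletApprox.errorIntegrand χ u s₀ ((σ : ℂ) + (t : ℂ) * Complex.I)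
          * Complex.I := by
  open DirichletApprox in
  have hσ0 : 0 < σ := zero_lt_one.trans hσ
  have hχ1 : χ ≠ 1 := by
    rintro rfl
    rw [DirichletCharacter.IsPrimitive, DirichletCharacter.conductor_one] at hχ
    exact hq.ne hχ
  have hχ1' : χ⁻¹ ≠ 1 := inv_ne_one.mpr hχ1
  have hE := hasDecayingReciprocal_truncXiInv χ u
  have hE' := hasDecayingReciprocal_truncXiInv χ⁻¹ u
  have i1 := integrable_xi hχ1 hσ hs₀
  have i2 := integrable_xi hχ1' hσ hs₀'
  have i3 := hE.integrable_line hσ0 hs₀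
  have i4 := hE'.integrable_line hσ0 hs₀'
  have i5 := i1.sub i3
  have i6 := (i2.sub i4).const_mul (eps χ)
  simp only [Pi.sub_def] at i5 i6
  -- On the line `ξ = g L` for both characters, and `χ` and `χ⁻¹` share the same `g`, so the
  -- integrand splits into four separately integrable Cauchy integrands.
  have hfun : (fun t : ℝ => errorIntegrand χ u s₀ ((σ : ℂ) + (t : ℂ) * I)) = fun t : ℝ =>
      (xi χ (σ + t * I) * (1 / (σ + t * I - s₀)) -
        (truncXiInv χ u (σ + t * I))⁻¹ * (1 / (σ + t * I - s₀))) +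
      eps χ * (xi χ⁻¹ (σ + t * I) * (1 / (σ + t * I - (1 - s₀))) -
        (truncXiInv χ⁻¹ u (σ + t * I))⁻¹ * (1 / (σ + t * I - (1 - s₀)))) := by
    funext t
    have hre : 0 < (σ + t * I : ℂ).re := by simpa using hσ0
    rw [xi_eq_of_re_pos hχ1 hre, xi_eq_of_re_pos hχ1' hre, ← congrFun (truncXi_eq χ u),
      ← congrFun (truncXi_eq χ⁻¹ u), truncXi, truncXi, gFactor_inv, errorIntegrand]
    ring
  refine ⟨⟨?_, ?_⟩, ?_, ?_⟩
  · rw [truncXi_eq]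
    exact hE.hasRegularPart
  · rw [truncXi_eq]
    exact hE'.hasRegularPart
  · rw [hfun]
    exact i5.add i6
  · rw [approxXi, truncXi_eq, truncXi_eq, hE.regularPart_eq hσ0 hs₀, hE'.regularPart_eq hσ0 hs₀',
      xi_eq_lineCauchy hχ hχ1 hσ hs₀ hs₀', MeasureTheory.integral_mul_const, hfun,
      MeasureTheory.integral_add i5 i6,
      MeasureTheory.integral_const_mul, MeasureTheory.integral_sub i1 i3,
      MeasureTheory.integral_sub i2 i4]
    simp only [lineCauchy, MeasureTheory.integral_mul_const]
    ring
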